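/- A radial weight is a function $\omega:[0,1)\to(0,\infty)$ such that $z\mapsto\omega(|z|)$ is integrable over the unit disc $\mathbb D$; write $\widehat\omega(r)=\int_r^1\omega(s)\,ds$. The weight $\omega$ is called regular if it is continuous and there are constants $c_1,c_2>0$ with $c_1(1-r)\le \widehat\omega(r)/\omega(r)\le c_2(1-r)$ for all $0\le r<1$. For $1<p<\infty$ let $L^p_{\widehat\omega}$ be the space of measurable $f:[0,1)\to\mathbb C$ with $\|f\|_{L^p_{\widehat\omega}}^p=\int_0^1|f(t)|^p\,\widehat\omega(t)\,dt<\infty$, and let $A^p_\omega$ be the space of analytic functions $F$ on $\mathbb D$ with $\|F\|_{A^p_\omega}^p=\frac1\pi\int_{\mathbb D}|F(z)|^p\,\omega(|z|)\,dx\,dy<\infty$. Set $$\mathcal H(f)(z)=\int_0^1\frac{f(t)}{1-tz}\,dt,\qquad \widetilde{\mathcal H}(f)(z)=\int_0^1\frac{|f(t)|}{1-tz}\,dt .$$ Theorem. Let $1<p<\infty$ and let $\omega$ be a regular weight with $\int_0^1\widehat\omega(t)^{-\frac1{p-1}}\,dt<\infty$. The following assertions are equivalent: (i) $\mathcal H:L^p_{\widehat\omega}\to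 A^p_\omega$ is bounded; (ii) $\widetilde{\mathcal H}:L^p_{\widehat\omega}\to A^p_\omega$ is bounded; (iii) $\displaystyle \mathcal M_p(\omega)=\sup_{0\le r<1}\left(\int_r^1\widehat\omega(t)^{-\frac1{p-1}}\,dt\right)^{1-\frac1p}\left(\int_0^r(1-t)^{-p}\,\widehat\omega(t)\,dt\right)^{\frac1p}<\infty .$ Moreover, if $\mathcal M_p(\omega)<\infty$, then $$\|\mathcal H\|_{(L^p_{\widehat\omega},A^p_\omega)}\asymp\|\widetilde{\mathcal H}\|_{(L^p_{\widehat\omega},A^p_\omega)}\asymp\mathcal M_p(\omega),$$ where the comparison constants depend only on $p$. -/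

import Mathlib

open MeasureTheory Set
open scoped ENNReal NNReal

noncomputable section

namespace HilbertBergman

/-- The normalized area measure `dA = dx dy / π` on the unit disc. -/
def areaMeasure : Measure ℂ :=
  ENNReal.ofReal (Real.pi⁻¹) • (volume.restrict (Metric.ball (0 : ℂ) 1))

/-- A radial weight: a positive function of `|z|`, integrable over the unit disc. It is given
by its radial profile `ω` on `[0,1)`; the values of `ω` elsewhere play no role. -/
structure IsRadialWeight (ω : ℝ → ℝ) : Prop where
  pos : ∀ r ∈ Ico (0 : ℝ) 1, 0 < ω r
  integrable : Integrable (fun z : ℂ => ω ‖z‖) areaMeasure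

/-- The tail integral `∫_r^1 ω(s) ds` of a radial weight. -/
def hat (ω : ℝ → ℝ) (r : ℝ) : ℝ := ∫ s in r..1, ω s

/-- The distortion function `ψ_ω(r) = (1 / ω(r)) ∫_r^1 ω(s) ds`. -/
def distortion (ω : ℝ → ℝ) (r : ℝ) : ℝ := 1 / ω r * hat ω r

/-- A regular weight: a continuous radial weight with `ψ_ω(r) ≍ 1 - r` on `[0,1)`. -/
structure IsRegularWeight (ω : ℝ → ℝ) : Prop extends IsRadialWeight ω where
  continuousOn : ContinuousOn ω (Ico (0 : ℝ) 1)
  distortion_comparable : ∃ c₁ c₂ : ℝ, 0 < c₁ ∧ 0 < c₂ ∧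
    ∀ r ∈ Ico (0 : ℝ) 1, c₁ * (1 - r) ≤ distortion ω r ∧ distortion ω r ≤ c₂ * (1 - r)

/-- The (extended) norm `(∫_D |F|^p ω dA)^(1/p)`. -/
def bergmanNorm (p : ℝ) (ω : ℝ → ℝ) (F : ℂ → ℂ) : ℝ≥0∞ :=
  (∫⁻ z, ‖F z‖ₑ ^ p * ENNReal.ofReal (ω ‖z‖) ∂areaMeasure) ^ (1 / p)

/-- Membership in the weighted Bergman space `A^p_ω`. -/
def MemBergman (p : ℝ) (ω : ℝ → ℝ) (F : ℂ → ℂ) : Prop :=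
  DifferentiableOn ℂ F (Metric.ball (0 : ℂ) 1) ∧ bergmanNorm p ω F < ∞

/-- The (extended) norm `(∫_0^1 |f|^p v dt)^(1/p)` for a weight `v` on `[0,1)`. -/
def weightedNorm (p : ℝ) (v : ℝ → ℝ) (f : ℝ → ℂ) : ℝ≥0∞ :=
  (∫⁻ t in Ico (0 : ℝ) 1, ‖f t‖ₑ ^ p * ENNReal.ofReal (v t)) ^ (1 / p)

/-- Membership in the weighted Lebesgue space `L^p_v([0,1))`. -/
def MemWeighted (p : ℝ) (v : ℝ → ℝ) (f : ℝ → ℂ) : Prop :=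
  AEStronglyMeasurable f (volume.restrict (Ico (0 : ℝ) 1)) ∧ weightedNorm p v f < ∞

/-- The Hilbert operator `H(f)(z) = ∫_0^1 f(t) / (1 - t z) dt`. -/
def hilbertOp (f : ℝ → ℂ) (z : ℂ) : ℂ := ∫ t in Ico (0 : ℝ) 1, f t / (1 - (t : ℂ) * z)

/-- The sublinear Hilbert operator `f ↦ ∫_0^1 |f(t)| / (1 - t z) dt`. -/
def sublinearHilbertOp (f : ℝ → ℂ) (z : ℂ) : ℂ :=
  ∫ t in Ico (0 : ℝ) 1, (‖f t‖ : ℂ) / (1 - (t : ℂ) * z)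

/-- `T` maps `L^p_v([0,1))`, `v` the tail integral of `ω`, boundedly into `A^p_ω`. -/
def IsBoundedOp (p : ℝ) (ω : ℝ → ℝ) (T : (ℝ → ℂ) → (ℂ → ℂ)) : Prop :=
  ∃ C : ℝ≥0, ∀ f : ℝ → ℂ, MemWeighted p (hat ω) f →
    MemBergman p ω (T f) ∧ bergmanNorm p ω (T f) ≤ C * weightedNorm p (hat ω) f

/-- The (extended) operator norm of `T` from `L^p_v([0,1))`, `v` the tail integral of `ω`,
to `A^p_ω`: the supremum of the norms of `T f` over the closed unit ball. -/
def opNorm (p : ℝ) (ω : ℝ → ℝ) (T : (ℝ → ℂ) → (ℂ → ℂ)) : ℝ≥0∞ :=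
  ⨆ (f : ℝ → ℂ) (_ : MemWeighted p (hat ω) f) (_ : weightedNorm p (hat ω) f ≤ 1),
    bergmanNorm p ω (T f)

/-- The Muckenhoupt type constant `M_p(ω)`, with values in `[0,∞]`. -/
def muckenhoupt (p : ℝ) (ω : ℝ → ℝ) : ℝ≥0∞ :=
  ⨆ r ∈ Ico (0 : ℝ) 1,
    (∫⁻ t in Ico r 1, ENNReal.ofReal (hat ω t ^ (-(1 / (p - 1))))) ^ (1 - 1 / p) *
      (∫⁻ t in Ico 0 r, ENNReal.ofReal ((1 - t) ^ (-p) * hat ω t)) ^ (1 / p)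

/-- `a ≍ b` with comparison constant `K`. -/
def Comparable (K : ℝ≥0) (a b : ℝ≥0∞) : Prop := a ≤ K * b ∧ b ≤ K * a

end HilbertBergman

end

noncomputable section

namespace HilbertBergman

variable {p : ℝ} {w ω : ℝ → ℝ}

/-! The problem reduces to a positive integral operator on `[0,1)`. For `z = r e^{iθ}` put `x = r (1
- |θ|/π)`; then `|1 - t z|` and `1 - t x` are comparable with absolute constants. The map `θ ↦ x`
carries `r dθ` to `2π dx` on `(0,r)`, so integrating a function of `x` against `ω(r) r dr dθ` gives
exactly `2π` times its integral against `hat ω`. For nonnegative `f` the values of the kernel lie in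
one quadrant, so no cancellation occurs, and the Bergman norm of `hilbertOp f` is comparable to the
`L^p(hat ω)` norm of `kernelAvg f`. For general `f` the upper estimate persists with `|f|`.

Upper bound: `kernelAvg` splits at `t = x` into a head `∫_0^x g(t)/(1-t) dt` and a tail `(1-x)⁻¹
∫_x^1 g`. The head is bounded for every decreasing weight (`hardy_head`); the tail is governed by
the Muckenhoupt constant (`hardy_tail`). Both follow from the Schur test `lintegral_rpow_kernel_le`.
Since the Muckenhoupt constant is at least `1/2` (`half_le_muckenhoupt`), it absorbs the head.

Lower bound: the extremal functions of the tail inequality, `(hat ω)^(-1/(p-1))` cut off to `[r,1)`,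
are nonnegative, hence test both operators at once (`muckenhoupt_le_opNorm`). -/

/-! ### Integration of nonnegative derivatives and the Schur test. -/

theorem lintegral_deriv_eq_of_nonneg {a b : ℝ} (hab : a ≤ b) {Φ φ : ℝ → ℝ}
    (hc : ContinuousOn Φ (Icc a b)) (hd : ∀ x ∈ Ioo a b, HasDerivAt Φ (φ x) x)
    (h0 : ∀ x ∈ Ioo a b, 0 ≤ φ x) :
    ∫⁻ x in Ioo a b, ENNReal.ofReal (φ x) = ENNReal.ofReal (Φ b - Φ a) := by
  have hi := intervalIntegral.integrableOn_deriv_of_nonneg hc hd h0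
  have hii : IntervalIntegrable φ volume a b := by
    rwa [intervalIntegrable_iff_integrableOn_Ioc_of_le hab]
  rw [← intervalIntegral.integral_eq_sub_of_hasDerivAt_of_le hab hc hd hii,
    intervalIntegral.integral_of_le hab, integral_Ioc_eq_integral_Ioo, ofReal_integral_eq_lintegral_ofReal (hi.mono_set Ioo_subset_Ioc_self)]
  exact (ae_restrict_iff' measurableSet_Ioo).2 (Filter.Eventually.of_forall h0)

/-- A two-weight Schur test for positive kernels. -/
theorem lintegral_rpow_kernel_le {α β : Type*} [MeasurableSpace α] [MeasurableSpace β]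
    {μ : Measure α} {ν : Measure β} [SFinite μ] [SFinite ν] {p : ℝ} (hp : 1 < p)
    {k : α → β → ℝ≥0∞} (hk : Measurable (Function.uncurry k)) {g Q V : β → ℝ≥0∞}
    {P u : α → ℝ≥0∞} (hg : AEMeasurable g ν) (hQ : AEMeasurable Q ν) (hP : AEMeasurable P μ)
    (hu : AEMeasurable u μ) (hQ0 : ∀ᵐ t ∂ν, Q t ≠ 0 ∧ Q t ≠ ∞) {A B : ℝ≥0∞} (hA : A ≠ ∞) (hB : B ≠ ∞)
    (h1 : ∀ᵐ x ∂μ, ∫⁻ t, k x t * Q t ∂ν ≤ A * P x)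
    (h2 : ∀ᵐ t ∂ν, (∫⁻ x, k x t * (P x ^ (p - 1) * u x) ∂μ) * Q t ^ (1 - p) ≤ B * V t) :
    ∫⁻ x, (∫⁻ t, k x t * g t ∂ν) ^ p * u x ∂μ ≤
      A ^ (p - 1) * B * ∫⁻ t, g t ^ p * V t ∂ν := by
  have hp0 : 0 < p := by linarith
  have hconj : (p / (p - 1)).HolderConjugate p := (Real.HolderConjugate.conjExponent hp).symm
  have hp1 : 0 < p - 1 := by linarith
  have hkx : ∀ x, Measurable (k x) := fun x => hk.of_uncurry_left
  have hkt : ∀ t, Measurable (fun x => k x t) := fun t => hk.of_uncurry_right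
  have holder : ∀ x, (∫⁻ t, k x t * g t ∂ν) ^ p ≤
      (∫⁻ t, k x t * Q t ∂ν) ^ (p - 1) * ∫⁻ t, k x t * (g t ^ p * Q t ^ (1 - p)) ∂ν := by
    intro x
    -- Hölder with `k g = (k Q)^(1/p') · (k^(1/p) g Q^(-1/p'))`, where `1/p' = (p-1)/p`.
    have hH := ENNReal.lintegral_mul_le_Lp_mul_Lq ν hconj
      (f := fun t => (k x t * Q t) ^ ((p - 1) / p))
      (g := fun t => k x t ^ (1 / p) * (g t * Q t ^ ((1 - p) / p)))
      (((hkx x).aemeasurable.mul hQ).pow_const _)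
      (((hkx x).aemeasurable.pow_const _).mul (hg.mul (hQ.pow_const _)))
    have e1 : ∫⁻ t, k x t * g t ∂ν = ∫⁻ t, ((fun t => (k x t * Q t) ^ ((p - 1) / p)) *
        (fun t => k x t ^ (1 / p) * (g t * Q t ^ ((1 - p) / p)))) t ∂ν := by
      refine lintegral_congr_ae (hQ0.mono fun t ht => ?_)
      simp only [Pi.mul_apply]
      rw [ENNReal.mul_rpow_of_nonneg _ _ (by positivity)]
      have a1 : k x t ^ ((p - 1) / p) * k x t ^ (1 / p) = k x t := by
        rw [← ENNReal.rpow_add_of_nonneg _ _ (by positivity) (by positivity),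
          show (p - 1) / p + 1 / p = 1 by field_simp; ring, ENNReal.rpow_one]
      have a2 : Q t ^ ((p - 1) / p) * Q t ^ ((1 - p) / p) = 1 := by
        rw [← ENNReal.rpow_add _ _ ht.1 ht.2, show (p - 1) / p + (1 - p) / p = 0 by
          field_simp; ring, ENNReal.rpow_zero]
      calc k x t * g t = (k x t ^ ((p - 1) / p) * k x t ^ (1 / p)) * g t *
            (Q t ^ ((p - 1) / p) * Q t ^ ((1 - p) / p)) := by rw [a1, a2, mul_one]
        _ = _ := by ring
    have e2 : ∀ t, ((k x t * Q t) ^ ((p - 1) / p)) ^ (p / (p - 1)) = k x t * Q t := by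
      intro t
      rw [← ENNReal.rpow_mul, show (p - 1) / p * (p / (p - 1)) = 1 by field_simp, ENNReal.rpow_one]
    have e3 : ∀ t, (k x t ^ (1 / p) * (g t * Q t ^ ((1 - p) / p))) ^ p =
        k x t * (g t ^ p * Q t ^ (1 - p)) := by
      intro t
      rw [ENNReal.mul_rpow_of_nonneg _ _ hp0.le, ENNReal.mul_rpow_of_nonneg _ _ hp0.le,
        ← ENNReal.rpow_mul, ← ENNReal.rpow_mul, show 1 / p * p = 1 by field_simp,
        show (1 - p) / p * p = 1 - p by field_simp, ENNReal.rpow_one]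
    rw [← e1] at hH
    simp only [e2, e3] at hH
    calc (∫⁻ t, k x t * g t ∂ν) ^ p ≤ _ := ENNReal.rpow_le_rpow hH hp0.le
      _ = _ := by
        rw [ENNReal.mul_rpow_of_nonneg _ _ hp0.le, ← ENNReal.rpow_mul, ← ENNReal.rpow_mul,
          show 1 / (p / (p - 1)) * p = p - 1 by field_simp, show 1 / p * p = 1 by field_simp,
          ENNReal.rpow_one]
  have step : ∀ᵐ x ∂μ, (∫⁻ t, k x t * g t ∂ν) ^ p * u x ≤
      ∫⁻ t, A ^ (p - 1) * (P x ^ (p - 1) * u x * (k x t * (g t ^ p * Q t ^ (1 - p)))) ∂ν := by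
    filter_upwards [h1] with x hx
    have hm : AEMeasurable (fun t => k x t * (g t ^ p * Q t ^ (1 - p))) ν :=
      (hkx x).aemeasurable.mul ((hg.pow_const _).mul (hQ.pow_const _))
    rw [lintegral_const_mul'' _ (hm.const_mul _), lintegral_const_mul'' _ hm]
    calc _ ≤ ((A * P x) ^ (p - 1) * ∫⁻ t, k x t * (g t ^ p * Q t ^ (1 - p)) ∂ν) * u x := by
          gcongr
          exact (holder x).trans (by gcongr)
      _ = _ := by rw [ENNReal.mul_rpow_of_nonneg _ _ hp1.le]; ring
  calc _ ≤ _ := lintegral_mono_ae step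
    _ = ∫⁻ t, ∫⁻ x, A ^ (p - 1) * (P x ^ (p - 1) * u x * (k x t * (g t ^ p * Q t ^ (1 - p)))) ∂μ ∂ν := by
        refine lintegral_lintegral_swap ?_
        refine AEMeasurable.const_mul ?_ _
        exact ((hP.comp_fst.pow_const _).mul hu.comp_fst).mul
          (hk.aemeasurable.mul ((hg.comp_snd.pow_const _).mul (hQ.comp_snd.pow_const _)))
    _ ≤ ∫⁻ t, A ^ (p - 1) * (B * (g t ^ p * V t)) ∂ν := by
        refine lintegral_mono_ae (h2.mono fun t ht => ?_)
        have hm : AEMeasurable (fun x => k x t * (P x ^ (p - 1) * u x)) μ :=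
          (hkt t).aemeasurable.mul ((hP.pow_const _).mul hu)
        have : ∀ x, A ^ (p - 1) * (P x ^ (p - 1) * u x * (k x t * (g t ^ p * Q t ^ (1 - p)))) =
            A ^ (p - 1) * g t ^ p * Q t ^ (1 - p) * (k x t * (P x ^ (p - 1) * u x)) := by
          intro x; ring
        simp only [this]
        rw [lintegral_const_mul'' _ hm]
        calc _ = A ^ (p - 1) * g t ^ p * ((∫⁻ x, k x t * (P x ^ (p - 1) * u x) ∂μ) * Q t ^ (1 - p)) := by
              ring
          _ ≤ A ^ (p - 1) * g t ^ p * (B * V t) := by gcongr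
          _ = _ := by ring
    _ ≤ _ := by
        rw [lintegral_const_mul' _ _ (ENNReal.rpow_ne_top_of_nonneg hp1.le hA),
          lintegral_const_mul' _ _ hB, mul_assoc]

/-! ### Polar coordinates and the substitution `x = r (1 - |θ|/π)`. -/

/-- Each half of the `θ`-interval is mapped affinely onto `(0,r)` with Jacobian `r/π`; the sign `σ`
treats both halves at once. -/
theorem lintegral_radial_subst {r : ℝ} (hr : 0 < r) (Φ : ℝ → ℝ≥0∞) :
    ENNReal.ofReal r * ∫⁻ θ in Ioo (-Real.pi) Real.pi, Φ (r * (1 - |θ| / Real.pi)) =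
      ENNReal.ofReal (2 * Real.pi) * ∫⁻ x in Ioo 0 r, Φ x := by
  have hπ := Real.pi_pos
  have key : ∀ (s : Set ℝ) (σ : ℝ), MeasurableSet s → |σ| = 1 →
      (fun θ => r * (1 - σ * θ / Real.pi)) '' s = Ioo 0 r →
      ENNReal.ofReal r * ∫⁻ θ in s, Φ (r * (1 - σ * θ / Real.pi)) =
        ENNReal.ofReal Real.pi * ∫⁻ x in Ioo 0 r, Φ x := by
    intro s σ hs hσ him
    have hd : ∀ θ ∈ s, HasDerivWithinAt (fun θ => r * (1 - σ * θ / Real.pi)) (r * (-(σ / Real.pi))) s θ := by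
      intro θ _
      have := ((((hasDerivAt_id θ).const_mul σ).div_const Real.pi).const_sub 1).const_mul r
      simpa using this.hasDerivWithinAt
    have hinj : InjOn (fun θ => r * (1 - σ * θ / Real.pi)) s := by
      intro a _ b _ h
      have hσ0 : σ ≠ 0 := by rintro rfl; simp at hσ
      simp only [mul_eq_mul_left_iff, hr.ne', or_false, sub_right_inj] at h
      rw [div_left_inj' hπ.ne'] at h
      exact mul_left_cancel₀ hσ0 h
    rw [← him, lintegral_image_eq_lintegral_abs_deriv_mul hs hd hinj,
      lintegral_const_mul' _ _ ENNReal.ofReal_ne_top, ← mul_assoc, ← ENNReal.ofReal_mul hπ.le]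
    congr 2
    rw [abs_mul, abs_neg, abs_div, hσ, abs_of_pos hr, abs_of_pos hπ]
    field_simp
  have k1 := key (Ioo 0 Real.pi) 1 measurableSet_Ioo (by simp) (by
    ext x; simp only [mem_image, mem_Ioo]
    constructor
    · rintro ⟨θ, ⟨h0, h1⟩, rfl⟩
      have h2 : 1 * θ / Real.pi < 1 := by rw [div_lt_one hπ]; linarith
      have h3 : 0 < 1 * θ / Real.pi := by positivity
      constructor <;> nlinarith
    · rintro ⟨h0, h1⟩
      have h2 : x / r < 1 := by rwa [div_lt_one hr]
      have h3 : 0 < x / r := by positivity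
      refine ⟨Real.pi * (1 - x / r), ⟨by nlinarith, by nlinarith⟩, ?_⟩
      field_simp; ring)
  have k2 := key (Ioo (-Real.pi) 0) (-1) measurableSet_Ioo (by simp) (by
    ext x; simp only [mem_image, mem_Ioo]
    constructor
    · rintro ⟨θ, ⟨h0, h1⟩, rfl⟩
      have h2 : -1 * θ / Real.pi < 1 := by rw [div_lt_one hπ]; linarith
      have h3 : 0 < -1 * θ / Real.pi := div_pos (by linarith) hπ
      constructor <;> nlinarith
    · rintro ⟨h0, h1⟩
      have h2 : x / r < 1 := by rwa [div_lt_one hr]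
      have h3 : 0 < x / r := by positivity
      refine ⟨-(Real.pi * (1 - x / r)), ⟨by nlinarith, by nlinarith⟩, ?_⟩
      field_simp; ring)
  have hsplit : ∫⁻ θ in Ioo (-Real.pi) Real.pi, Φ (r * (1 - |θ| / Real.pi)) =
      (∫⁻ θ in Ioo (-Real.pi) 0, Φ (r * (1 - -1 * θ / Real.pi))) +
        ∫⁻ θ in Ioo 0 Real.pi, Φ (r * (1 - 1 * θ / Real.pi)) := by
    rw [← Ioo_union_Ico_eq_Ioo (show -Real.pi < 0 by linarith) hπ.le,
      lintegral_union measurableSet_Ico (Set.disjoint_left.2 fun x h1 h2 => absurd h1.2 (not_lt.2 h2.1)),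
      setLIntegral_congr (Ioo_ae_eq_Ico (μ := volume) (a := (0:ℝ)) (b := Real.pi)).symm]
    congr 1
    · refine setLIntegral_congr_fun measurableSet_Ioo fun θ hθ => ?_
      simp only [abs_of_neg hθ.2, neg_one_mul]
    · refine setLIntegral_congr_fun measurableSet_Ioo fun θ hθ => ?_
      simp only [abs_of_pos hθ.1, one_mul]
  rw [hsplit, mul_add, k1, k2, two_mul, ENNReal.ofReal_add hπ.le hπ.le, add_mul]

theorem lintegral_ball_eq_polar (F : ℂ → ℝ≥0∞) :
    ∫⁻ z in Metric.ball (0 : ℂ) 1, F z =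
      ∫⁻ q in Ioo (0 : ℝ) 1 ×ˢ Ioo (-Real.pi) Real.pi,
        ENNReal.ofReal q.1 * F (Complex.polarCoord.symm q) := by
  rw [← lintegral_indicator Metric.isOpen_ball.measurableSet, ← Complex.lintegral_comp_polarCoord_symm,
    polarCoord_target, ← lintegral_indicator (measurableSet_Ioi.prod measurableSet_Ioo),
    ← lintegral_indicator (measurableSet_Ioo.prod measurableSet_Ioo)]
  refine lintegral_congr fun q => ?_
  by_cases h : q ∈ Ioi (0 : ℝ) ×ˢ Ioo (-Real.pi) Real.pi
  · have hn : ‖Complex.polarCoord.symm q‖ = q.1 := by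
      rw [Complex.norm_polarCoord_symm, abs_of_pos h.1]
    by_cases h1 : q.1 < 1
    · have h' : q ∈ Ioo (0 : ℝ) 1 ×ˢ Ioo (-Real.pi) Real.pi := ⟨⟨h.1, h1⟩, h.2⟩
      have hb : Complex.polarCoord.symm q ∈ Metric.ball (0 : ℂ) 1 := by
        rw [mem_ball_zero_iff, hn]; exact h1
      rw [indicator_of_mem h, indicator_of_mem h', indicator_of_mem hb, smul_eq_mul]
    · have h' : q ∉ Ioo (0 : ℝ) 1 ×ˢ Ioo (-Real.pi) Real.pi := fun h' => h1 h'.1.2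
      have hb : Complex.polarCoord.symm q ∉ Metric.ball (0 : ℂ) 1 := by
        rw [mem_ball_zero_iff, hn]; exact h1
      rw [indicator_of_mem h, indicator_of_notMem h', indicator_of_notMem hb, smul_zero]
  · have h' : q ∉ Ioo (0 : ℝ) 1 ×ˢ Ioo (-Real.pi) Real.pi := fun h' => h ⟨h'.1.1, h'.2⟩
    rw [indicator_of_notMem h, indicator_of_notMem h']

/-- The indicator of `s < t`. -/
def stepKernel (s t : ℝ) : ℝ≥0∞ := (Iio t).indicator 1 s

theorem measurable_stepKernel : Measurable (Function.uncurry stepKernel) := by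
  have : Function.uncurry stepKernel = {q : ℝ × ℝ | q.1 < q.2}.indicator 1 := by
    ext q; simp [stepKernel, indicator, Function.uncurry]
  rw [this]
  exact measurable_one.indicator (measurableSet_lt measurable_fst measurable_snd)

theorem lintegral_stepKernel_left {x : ℝ} (hx : x ≤ 1) (F : ℝ → ℝ≥0∞) :
    ∫⁻ t in Ioo (0 : ℝ) 1, stepKernel t x * F t = ∫⁻ t in Ioo 0 x, F t := by
  rw [← lintegral_indicator measurableSet_Ioo, ← lintegral_indicator measurableSet_Ioo]
  refine lintegral_congr fun t => ?_
  by_cases ht : t < x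
  · simp [stepKernel, indicator, ht, ht.trans_le hx]
  · simp [stepKernel, indicator, ht]

theorem lintegral_stepKernel_right {x : ℝ} (hx : 0 ≤ x) (F : ℝ → ℝ≥0∞) :
    ∫⁻ t in Ioo (0 : ℝ) 1, stepKernel x t * F t = ∫⁻ t in Ioo x 1, F t := by
  rw [← lintegral_indicator measurableSet_Ioo, ← lintegral_indicator measurableSet_Ioo]
  refine lintegral_congr fun t => ?_
  by_cases ht : x < t
  · simp [stepKernel, indicator, ht, hx.trans_lt ht]
  · simp [stepKernel, indicator, ht]

/-- The polar Jacobian `r` is the factor that `lintegral_radial_subst` consumes. Exchanging the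
integrals over `x < r` then turns `w` into its tail, which is why the tail integral is the natural
weight on `[0,1)`. -/
theorem lintegral_polar_radial {Φ w : ℝ → ℝ≥0∞} (hΦ : Measurable Φ) (hw : Measurable w) :
    ∫⁻ q in Ioo (0 : ℝ) 1 ×ˢ Ioo (-Real.pi) Real.pi,
        ENNReal.ofReal q.1 * (Φ (q.1 * (1 - |q.2| / Real.pi)) * w q.1) =
      ENNReal.ofReal (2 * Real.pi) * ∫⁻ x in Ioo (0 : ℝ) 1, Φ x * ∫⁻ r in Ioo x 1, w r := by
  rw [Measure.volume_eq_prod, ← Measure.prod_restrict, lintegral_prod _ (by fun_prop)]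
  have h1 : ∀ r ∈ Ioo (0 : ℝ) 1, ∫⁻ θ in Ioo (-Real.pi) Real.pi,
      ENNReal.ofReal r * (Φ (r * (1 - |θ| / Real.pi)) * w r) =
      ENNReal.ofReal (2 * Real.pi) * ∫⁻ x in Ioo (0 : ℝ) 1, stepKernel x r * (Φ x * w r) := by
    intro r hr
    have e : ∀ θ, ENNReal.ofReal r * (Φ (r * (1 - |θ| / Real.pi)) * w r) =
      ENNReal.ofReal r * w r * Φ (r * (1 - |θ| / Real.pi)) := fun θ => by ring
    simp only [e]
    rw [lintegral_const_mul _ (by fun_prop), lintegral_stepKernel_left hr.2.le,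
      lintegral_mul_const _ hΦ, mul_right_comm, lintegral_radial_subst hr.1, mul_assoc]
  rw [setLIntegral_congr_fun measurableSet_Ioo h1, lintegral_const_mul' _ _ ENNReal.ofReal_ne_top,
    lintegral_lintegral_swap]
  · congr 1
    refine setLIntegral_congr_fun measurableSet_Ioo fun x hx => ?_
    rw [lintegral_stepKernel_right hx.1.le, lintegral_const_mul _ hw]
  · refine Measurable.aemeasurable ?_
    exact (measurable_stepKernel.comp measurable_swap).mul
      ((hΦ.comp measurable_snd).mul (hw.comp measurable_fst))

/-! ### Comparison of the complex kernel with the real one. -/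

/-- The Hilbert operator on nonnegative functions, restricted to real arguments. -/
def kernelAvg (g : ℝ → ℝ≥0∞) (x : ℝ) : ℝ≥0∞ :=
  ∫⁻ t in Ico (0 : ℝ) 1, g t * ENNReal.ofReal (1 - t * x)⁻¹

theorem measurable_kernelAvg {g : ℝ → ℝ≥0∞} (hg : AEMeasurable g (volume.restrict (Ico (0 : ℝ) 1))) :
    Measurable (kernelAvg g) := by
  have h : kernelAvg g = kernelAvg (hg.mk g) := by
    funext x
    exact lintegral_congr_ae (hg.ae_eq_mk.mono fun t ht => by simp only [ht])
  rw [h]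
  have := hg.measurable_mk
  refine Measurable.lintegral_prod_right' (ν := volume.restrict (Ico (0 : ℝ) 1))
    (f := fun q : ℝ × ℝ => hg.mk g q.2 * ENNReal.ofReal (1 - q.2 * q.1)⁻¹) ?_
  fun_prop

theorem norm_one_sub_mul_polar_sq (t r θ : ℝ) :
    ‖1 - (t : ℂ) * Complex.polarCoord.symm (r, θ)‖ ^ 2 =
      (1 - t * r) ^ 2 + 2 * (t * r) * (1 - Real.cos θ) := by
  rw [Complex.sq_norm, Complex.normSq_apply, Complex.polarCoord_symm_apply]
  simp [-Complex.ofReal_cos, -Complex.ofReal_sin]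
  linear_combination (t * r) ^ 2 * Real.sin_sq_add_cos_sq θ

/-- With `s = t r` and `τ = |θ|/π` one has `1 - t x = (1 - s) + s τ`. The bound `1 - cos θ ≥ 2 τ²`
makes the squared norm at least `(1-s)² + 4 s τ²`, and `s² ≤ s`. -/
theorem half_le_norm_one_sub_mul_polar {t r θ : ℝ} (ht : t ∈ Ico (0 : ℝ) 1) (hr : r ∈ Ioo (0 : ℝ) 1)
    (hθ : θ ∈ Ioo (-Real.pi) Real.pi) :
    (1 - t * (r * (1 - |θ| / Real.pi))) / 2 ≤ ‖1 - (t : ℂ) * Complex.polarCoord.symm (r, θ)‖ := by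
  have hπ := Real.pi_pos
  have hθ' : |θ| ≤ Real.pi := abs_le.2 ⟨hθ.1.le, hθ.2.le⟩
  have hc := Real.cos_le_one_sub_mul_cos_sq hθ'
  have hs0 : 0 ≤ t * r := mul_nonneg ht.1 hr.1.le
  have hs1 : t * r ≤ 1 := by nlinarith [ht.1, ht.2, hr.1, hr.2]
  set τ := |θ| / Real.pi with hτ
  have hθτ : 2 / Real.pi ^ 2 * θ ^ 2 = 2 * τ ^ 2 := by
    rw [hτ, div_pow, sq_abs]; ring
  rw [hθτ] at hc
  have e : 1 - t * (r * (1 - τ)) = 1 - t * r + t * r * τ := by ring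
  rw [e]
  refine abs_le_of_sq_le_sq' ?_ (norm_nonneg _) |>.2
  rw [norm_one_sub_mul_polar_sq]
  generalize t * r = s at *
  have h1 : s * (2 * τ ^ 2) ≤ s * (1 - Real.cos θ) := by
    gcongr; linarith
  have h2 : s ^ 2 * τ ^ 2 ≤ s * τ ^ 2 := by
    gcongr; nlinarith
  nlinarith [sq_nonneg (1 - s - s * τ), sq_nonneg (1 - s), sq_nonneg (s * τ)]

/-- The converse uses `1 - cos θ ≤ θ²/2 = π² τ²/2`. -/
theorem norm_one_sub_mul_polar_le {t r θ : ℝ} (ht : t ∈ Ico (0 : ℝ) 1) (hr : r ∈ Ioo (0 : ℝ) 1)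
    (hθ : θ ∈ Ioo (-Real.pi) Real.pi) :
    ‖1 - (t : ℂ) * Complex.polarCoord.symm (r, θ)‖ ≤
      Real.pi * (1 - t * (r * (1 - |θ| / Real.pi))) := by
  have hπ := Real.pi_pos
  have hθ' : |θ| < Real.pi := abs_lt.2 ⟨hθ.1, hθ.2⟩
  have hc := Real.one_sub_sq_div_two_le_cos (x := θ)
  have hπ1 : 1 ≤ Real.pi := by linarith [Real.pi_gt_three]
  have hs0 : 0 ≤ t * r := mul_nonneg ht.1 hr.1.le
  have hs1 : t * r ≤ 1 := by nlinarith [ht.1, ht.2, hr.1, hr.2]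
  set τ := |θ| / Real.pi with hτ
  have hτ0 : 0 ≤ τ := by positivity
  have hτ1 : τ < 1 := by rw [hτ, div_lt_one hπ]; exact hθ'
  have hθτ : θ ^ 2 = Real.pi ^ 2 * τ ^ 2 := by
    rw [hτ, div_pow, sq_abs]; field_simp
  have e : 1 - t * (r * (1 - τ)) = 1 - t * r + t * r * τ := by ring
  rw [e]
  refine abs_le_of_sq_le_sq' ?_ (by have := mul_nonneg hs0 hτ0; nlinarith) |>.2
  rw [norm_one_sub_mul_polar_sq]
  generalize t * r = s at *
  have h1 : 2 * s * (1 - Real.cos θ) ≤ Real.pi ^ 2 * (s * τ ^ 2) := by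
    have : 1 - Real.cos θ ≤ Real.pi ^ 2 * τ ^ 2 / 2 := by linarith
    nlinarith
  have h2 : (1 - s) ^ 2 + s * τ ^ 2 ≤ (1 - s + s * τ) ^ 2 := by
    -- This product is exactly the difference of the two sides.
    have : 0 ≤ s * (1 - s) * (τ * (2 - τ)) := by
      apply mul_nonneg (mul_nonneg hs0 (by linarith)) (mul_nonneg hτ0 (by linarith))
    nlinarith
  have h3 : (1 - s) ^ 2 ≤ Real.pi ^ 2 * (1 - s) ^ 2 :=
    le_mul_of_one_le_left (sq_nonneg _) (one_le_pow₀ hπ1)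
  calc _ ≤ Real.pi ^ 2 * ((1 - s) ^ 2 + s * τ ^ 2) := by linarith
    _ ≤ Real.pi ^ 2 * (1 - s + s * τ) ^ 2 := by gcongr
    _ = _ := by ring

theorem one_sub_norm_le {t : ℝ} (ht : t ∈ Ico (0 : ℝ) 1) (z : ℂ) : 1 - ‖z‖ ≤ ‖1 - (t : ℂ) * z‖ := by
  have h := norm_sub_norm_le (1 : ℂ) ((t : ℂ) * z)
  rw [norm_one, norm_mul, Complex.norm_real, Real.norm_of_nonneg ht.1] at h
  nlinarith [norm_nonneg z, ht.2]

theorem integrable_div_one_sub_mul {f : ℝ → ℂ} (hf : IntegrableOn f (Ico (0 : ℝ) 1)) {z : ℂ}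
    (hz : ‖z‖ < 1) : IntegrableOn (fun t : ℝ => f t / (1 - (t : ℂ) * z)) (Ico (0 : ℝ) 1) := by
  simp only [div_eq_mul_inv]
  refine Integrable.mul_bdd (c := (1 - ‖z‖)⁻¹) hf (by fun_prop) ?_
  refine (ae_restrict_iff' measurableSet_Ico).2 (Filter.Eventually.of_forall fun t ht => ?_)
  rw [norm_inv]
  exact inv_anti₀ (by linarith) (one_sub_norm_le ht z)

theorem differentiableOn_hilbertOp {f : ℝ → ℂ} (hf : IntegrableOn f (Ico (0 : ℝ) 1)) :
    DifferentiableOn ℂ (hilbertOp f) (Metric.ball (0 : ℂ) 1) := by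
  intro z₀ hz₀
  rw [mem_ball_zero_iff] at hz₀
  -- On the ball of radius `ρ < 1` the derivative of the kernel is bounded by `(1 - ρ)⁻²`, uniformly
  -- in `t`.
  set ρ := (1 + ‖z₀‖) / 2
  have hρ1 : ρ < 1 := by simp only [ρ]; linarith
  have hρ0 : ‖z₀‖ < ρ := by simp only [ρ]; linarith
  have hs : Metric.ball (0 : ℂ) ρ ∈ nhds z₀ := Metric.isOpen_ball.mem_nhds (by simpa using hρ0)
  have h := hasDerivAt_integral_of_dominated_loc_of_deriv_le (μ := volume.restrict (Ico (0 : ℝ) 1))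
    (F := fun z t => f t / (1 - (t : ℂ) * z)) (F' := fun z t => f t * (t / (1 - (t : ℂ) * z) ^ 2))
    (bound := fun t => ‖f t‖ * (1 / (1 - ρ) ^ 2)) hs
    (by
      filter_upwards [hs] with z hz
      rw [mem_ball_zero_iff] at hz
      exact (integrable_div_one_sub_mul hf (hz.trans hρ1)).aestronglyMeasurable)
    (integrable_div_one_sub_mul hf hz₀)
    (hf.aestronglyMeasurable.mul (Measurable.aestronglyMeasurable (by fun_prop)))
    ((ae_restrict_iff' measurableSet_Ico).2 (Filter.Eventually.of_forall fun t ht z hz => ?_))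
    (hf.norm.mul_const _)
    ((ae_restrict_iff' measurableSet_Ico).2 (Filter.Eventually.of_forall fun t ht z hz => ?_))
  · exact h.2.differentiableAt.differentiableWithinAt
  · rw [mem_ball_zero_iff] at hz
    have h1 := one_sub_norm_le ht z
    rw [norm_mul, norm_div, norm_pow, Complex.norm_real, Real.norm_of_nonneg ht.1]
    have h2 : 1 - ρ ≤ ‖1 - (t : ℂ) * z‖ := by linarith
    have h3 : 0 < 1 - ρ := by linarith
    gcongr
    exact ht.2.le
  · rw [mem_ball_zero_iff] at hz
    have h1 := one_sub_norm_le ht z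
    have h0 : 1 - (t : ℂ) * z ≠ 0 := norm_pos_iff.1 (by linarith)
    have := (((hasDerivAt_id z).const_mul (t : ℂ)).const_sub 1).inv h0
    have := this.const_mul (f t)
    simpa [div_eq_mul_inv] using this

theorem enorm_hilbertOp_le (f : ℝ → ℂ) {r θ : ℝ} (hr : r ∈ Ioo (0 : ℝ) 1)
    (hθ : θ ∈ Ioo (-Real.pi) Real.pi) :
    ‖hilbertOp f (Complex.polarCoord.symm (r, θ))‖ₑ ≤
      2 * kernelAvg (fun t => ‖f t‖ₑ) (r * (1 - |θ| / Real.pi)) := by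
  have hπ := Real.pi_pos
  have hθ' : |θ| < Real.pi := abs_lt.2 ⟨hθ.1, hθ.2⟩
  refine (enorm_integral_le_lintegral_enorm _).trans ?_
  rw [kernelAvg, ← lintegral_const_mul' _ _ (by simp)]
  refine setLIntegral_mono' measurableSet_Ico fun t ht => ?_
  have hτ : |θ| / Real.pi < 1 := by rwa [div_lt_one hπ]
  have hτ0 : 0 ≤ |θ| / Real.pi := by positivity
  have hx : r * (1 - |θ| / Real.pi) < 1 := by nlinarith [hr.1, hr.2]
  have hx0 : 0 ≤ r * (1 - |θ| / Real.pi) := mul_nonneg hr.1.le (by linarith)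
  have hpos : 0 < 1 - t * (r * (1 - |θ| / Real.pi)) := by nlinarith [ht.1, ht.2]
  have hb := half_le_norm_one_sub_mul_polar ht hr hθ
  rw [div_eq_mul_inv, enorm_mul, mul_left_comm]
  gcongr
  rw [← ofReal_norm, norm_inv, ← ENNReal.ofReal_ofNat, ← ENNReal.ofReal_mul (by norm_num)]
  apply ENNReal.ofReal_le_ofReal
  calc _ ≤ ((1 - t * (r * (1 - |θ| / Real.pi))) / 2)⁻¹ := inv_anti₀ (by positivity) hb
    _ = _ := by rw [inv_div]; rfl

/-- For fixed `z`, the numbers `1/(1 - t z)` have nonnegative real part and imaginary part of the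
sign of `Im z`. Multiplication by `1 - σ i`, with `σ` that sign, gives real part `(|Re| + |Im|)` of
the kernel, which dominates its modulus; the real part commutes with the integral. -/
theorem kernelAvg_le_enorm_hilbertOp {φ : ℝ → ℝ} (hφ : IntegrableOn φ (Ico (0 : ℝ) 1))
    (h0 : ∀ t, 0 ≤ φ t) {r θ : ℝ} (hr : r ∈ Ioo (0 : ℝ) 1) (hθ : θ ∈ Ioo (-Real.pi) Real.pi) :
    kernelAvg (fun t => ENNReal.ofReal (φ t)) (r * (1 - |θ| / Real.pi)) ≤
      ENNReal.ofReal (2 * Real.pi) *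
        ‖hilbertOp (fun t => (φ t : ℂ)) (Complex.polarCoord.symm (r, θ))‖ₑ := by
  have hπ := Real.pi_pos
  have hθ' : |θ| < Real.pi := abs_lt.2 ⟨hθ.1, hθ.2⟩
  set z := Complex.polarCoord.symm (r, θ) with hz
  have hzn : ‖z‖ < 1 := by
    rw [hz, Complex.norm_polarCoord_symm, abs_of_pos hr.1]; exact hr.2
  obtain ⟨σ, hσ, hσz⟩ : ∃ σ : ℝ, |σ| = 1 ∧ 0 ≤ σ * z.im := by
    rcases le_total 0 z.im with h | h
    · exact ⟨1, by simp, by simpa⟩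
    · exact ⟨-1, by simp, by simpa⟩
  have hint := integrable_div_one_sub_mul (f := fun t => (φ t : ℂ)) hφ.ofReal hzn
  have hre : ∀ t ∈ Ico (0 : ℝ) 1, φ t * (1 - t * (r * (1 - |θ| / Real.pi)))⁻¹ ≤
      Real.pi * ((1 - σ * Complex.I) * ((φ t : ℂ) / (1 - (t : ℂ) * z))).re := by
    intro t ht
    have hb := norm_one_sub_mul_polar_le ht hr hθ
    rw [← hz] at hb
    have hpos : 0 < ‖1 - (t : ℂ) * z‖ := by linarith [one_sub_norm_le ht z]
    have hn : ‖1 - (t : ℂ) * z‖ ≤ (1 - t * z.re) + σ * (t * z.im) := by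
      have h1 := Complex.norm_le_abs_re_add_abs_im (1 - (t : ℂ) * z)
      simp only [Complex.sub_re, Complex.one_re, Complex.mul_re, Complex.ofReal_re,
        Complex.ofReal_im, zero_mul, sub_zero, Complex.sub_im, Complex.one_im, Complex.mul_im,
        add_zero, zero_sub, abs_neg] at h1
      have h2 : |z.re| < 1 := (Complex.abs_re_le_norm z).trans_lt hzn
      have h3 : |1 - t * z.re| = 1 - t * z.re := by
        apply abs_of_nonneg
        nlinarith [ht.1, ht.2, (abs_lt.1 h2).2]
      have h4 : |t * z.im| = σ * (t * z.im) := by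
        have : 0 ≤ σ * (t * z.im) := by
          rw [mul_left_comm]; exact mul_nonneg ht.1 hσz
        rw [← abs_of_nonneg this, abs_mul σ, hσ, one_mul]
      linarith
    have hval : ((1 - σ * Complex.I) * ((φ t : ℂ) / (1 - (t : ℂ) * z))).re =
        φ t * (((1 - t * z.re) + σ * (t * z.im)) / ‖1 - (t : ℂ) * z‖ ^ 2) := by
      rw [Complex.sq_norm, div_eq_mul_inv, Complex.inv_def]
      simp
      ring
    rw [hval]
    have h5 : ‖1 - (t : ℂ) * z‖⁻¹ ≤ ((1 - t * z.re) + σ * (t * z.im)) / ‖1 - (t : ℂ) * z‖ ^ 2 := by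
      rw [le_div_iff₀ (by positivity)]
      calc _ = ‖1 - (t : ℂ) * z‖ := by field_simp
        _ ≤ _ := hn
    have h6 : (1 - t * (r * (1 - |θ| / Real.pi)))⁻¹ ≤ Real.pi * ‖1 - (t : ℂ) * z‖⁻¹ := by
      have : (Real.pi * (1 - t * (r * (1 - |θ| / Real.pi))))⁻¹ ≤ ‖1 - (t : ℂ) * z‖⁻¹ :=
        inv_anti₀ hpos hb
      rw [mul_inv] at this
      calc _ = Real.pi * (Real.pi⁻¹ * (1 - t * (r * (1 - |θ| / Real.pi)))⁻¹) := by field_simp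
        _ ≤ _ := by gcongr
    calc _ ≤ φ t * (Real.pi * (((1 - t * z.re) + σ * (t * z.im)) / ‖1 - (t : ℂ) * z‖ ^ 2)) := by
          have := h0 t
          gcongr
          exact h6.trans (by gcongr)
      _ = _ := by ring
  have hint2 := (hint.const_mul (1 - σ * Complex.I)).re.const_mul Real.pi
  have hnn : ∀ t ∈ Ico (0 : ℝ) 1, 0 ≤ φ t * (1 - t * (r * (1 - |θ| / Real.pi)))⁻¹ := by
    intro t ht
    have hτ : |θ| / Real.pi < 1 := by rwa [div_lt_one hπ]
    have hτ0 : 0 ≤ |θ| / Real.pi := by positivity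
    have hx : r * (1 - |θ| / Real.pi) < 1 := by nlinarith [hr.1, hr.2]
    have hpos : 0 ≤ 1 - t * (r * (1 - |θ| / Real.pi)) := by nlinarith [ht.1, ht.2]
    exact mul_nonneg (h0 t) (inv_nonneg.2 hpos)
  calc kernelAvg (fun t => ENNReal.ofReal (φ t)) (r * (1 - |θ| / Real.pi))
      ≤ ∫⁻ t in Ico (0 : ℝ) 1, ENNReal.ofReal
        (Real.pi * ((1 - σ * Complex.I) * ((φ t : ℂ) / (1 - (t : ℂ) * z))).re) := by
        refine setLIntegral_mono' measurableSet_Ico fun t ht => ?_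
        rw [← ENNReal.ofReal_mul (h0 t)]
        exact ENNReal.ofReal_le_ofReal (hre t ht)
    _ = ENNReal.ofReal (∫ t in Ico (0 : ℝ) 1,
        Real.pi * ((1 - σ * Complex.I) * ((φ t : ℂ) / (1 - (t : ℂ) * z))).re) := by
        refine (ofReal_integral_eq_lintegral_ofReal hint2 ?_).symm
        exact (ae_restrict_iff' measurableSet_Ico).2
          (Filter.Eventually.of_forall fun t ht => (hnn t ht).trans (hre t ht))
    _ = ENNReal.ofReal (Real.pi * ((1 - σ * Complex.I) * hilbertOp (fun t => (φ t : ℂ)) z).re) := by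
        have := integral_re (hint.const_mul (1 - σ * Complex.I))
        rw [integral_const_mul]
        simp only [RCLike.re_to_complex] at this
        rw [this, integral_const_mul]
        rfl
    _ ≤ ENNReal.ofReal (2 * Real.pi * ‖hilbertOp (fun t => (φ t : ℂ)) z‖) := by
        apply ENNReal.ofReal_le_ofReal
        have h1 : ‖(1 : ℂ) - σ * Complex.I‖ ≤ 2 := by
          refine (norm_sub_le _ _).trans ?_
          rw [norm_mul, Complex.norm_real, Complex.norm_I, Real.norm_eq_abs, hσ]
          norm_num
        calc _ ≤ Real.pi * ‖(1 - σ * Complex.I) * hilbertOp (fun t => (φ t : ℂ)) z‖ := by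
              gcongr; exact Complex.re_le_norm _
          _ ≤ Real.pi * (2 * ‖hilbertOp (fun t => (φ t : ℂ)) z‖) := by
              rw [norm_mul]; gcongr
          _ = _ := by ring
    _ = _ := by rw [ENNReal.ofReal_mul (by positivity), ofReal_norm]

/-! ### Bergman norms as integrals over `[0,1)`. -/

theorem lintegral_bergman_eq (F : ℂ → ℂ) :
    ∫⁻ z, ‖F z‖ₑ ^ p * ENNReal.ofReal (ω ‖z‖) ∂areaMeasure =
      ENNReal.ofReal Real.pi⁻¹ * ∫⁻ q in Ioo (0 : ℝ) 1 ×ˢ Ioo (-Real.pi) Real.pi,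
        ENNReal.ofReal q.1 * (‖F (Complex.polarCoord.symm q)‖ₑ ^ p *
          (Ico (0 : ℝ) 1).indicator (fun r => ENNReal.ofReal (ω r)) q.1) := by
  rw [areaMeasure, lintegral_smul_measure, smul_eq_mul, lintegral_ball_eq_polar]
  congr 1
  refine setLIntegral_congr_fun (measurableSet_Ioo.prod measurableSet_Ioo) fun q hq => ?_
  rw [Complex.norm_polarCoord_symm, abs_of_pos hq.1.1,
    indicator_of_mem (show q.1 ∈ Ico (0 : ℝ) 1 from ⟨hq.1.1.le, hq.1.2⟩)]

theorem measurable_weight_indicator (hω : ContinuousOn ω (Ico (0 : ℝ) 1)) :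
    Measurable ((Ico (0 : ℝ) 1).indicator fun r => ENNReal.ofReal (ω r)) := by
  have h : (Ico (0 : ℝ) 1).indicator (fun r => ENNReal.ofReal (ω r)) =
      fun r => ENNReal.ofReal ((Ico (0 : ℝ) 1).piecewise ω 0 r) := by
    funext r
    by_cases hr : r ∈ Ico (0 : ℝ) 1
    · simp only [indicator_of_mem hr, piecewise_eq_of_mem _ _ _ hr]
    · simp [indicator_of_notMem hr, piecewise_eq_of_notMem _ _ _ hr]
  rw [h]
  exact (hω.measurable_piecewise continuousOn_const measurableSet_Ico).ennreal_ofReal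

theorem lintegral_polar_weight (hω : ContinuousOn ω (Ico (0 : ℝ) 1)) {Φ : ℝ → ℝ≥0∞}
    (hΦ : Measurable Φ) :
    ENNReal.ofReal Real.pi⁻¹ * ∫⁻ q in Ioo (0 : ℝ) 1 ×ˢ Ioo (-Real.pi) Real.pi,
        ENNReal.ofReal q.1 * (Φ (q.1 * (1 - |q.2| / Real.pi)) *
          (Ico (0 : ℝ) 1).indicator (fun r => ENNReal.ofReal (ω r)) q.1) =
      2 * ∫⁻ x in Ioo (0 : ℝ) 1, Φ x * ∫⁻ r in Ioo x 1, ENNReal.ofReal (ω r) := by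
  rw [lintegral_polar_radial hΦ (measurable_weight_indicator hω), ← mul_assoc,
    ← ENNReal.ofReal_mul (by positivity), show Real.pi⁻¹ * (2 * Real.pi) = 2 by field_simp,
    ENNReal.ofReal_ofNat]
  congr 1
  refine setLIntegral_congr_fun measurableSet_Ioo fun x hx => ?_
  congr 1
  exact setLIntegral_congr_fun measurableSet_Ioo fun r hr =>
    indicator_of_mem (show r ∈ Ico (0 : ℝ) 1 from ⟨hx.1.le.trans hr.1.le, hr.2⟩) _

theorem lintegral_hilbertOp_le (hp : 0 < p) (hω : ContinuousOn ω (Ico (0 : ℝ) 1)) {f : ℝ → ℂ}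
    (hf : AEStronglyMeasurable f (volume.restrict (Ico (0 : ℝ) 1))) :
    ∫⁻ z, ‖hilbertOp f z‖ₑ ^ p * ENNReal.ofReal (ω ‖z‖) ∂areaMeasure ≤
      2 * 2 ^ p * ∫⁻ x in Ioo (0 : ℝ) 1, kernelAvg (fun t => ‖f t‖ₑ) x ^ p *
        ∫⁻ r in Ioo x 1, ENNReal.ofReal (ω r) := by
  have hm : Measurable (kernelAvg fun t => ‖f t‖ₑ) := measurable_kernelAvg hf.enorm
  have h := lintegral_polar_weight hω (Φ := fun x => (2 * kernelAvg (fun t => ‖f t‖ₑ) x) ^ p)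
    (by fun_prop)
  rw [lintegral_bergman_eq]
  calc _ ≤ _ := by
        gcongr ENNReal.ofReal Real.pi⁻¹ * ?_
        refine setLIntegral_mono' (measurableSet_Ioo.prod measurableSet_Ioo) fun q hq => ?_
        gcongr
        exact enorm_hilbertOp_le f hq.1 hq.2
    _ = _ := h
    _ = _ := by
        simp only [ENNReal.mul_rpow_of_nonneg _ _ hp.le, mul_assoc]
        rw [lintegral_const_mul' _ _ (by simp)]

theorem lintegral_kernelAvg_le (hp : 0 < p) (hω : ContinuousOn ω (Ico (0 : ℝ) 1)) {φ : ℝ → ℝ}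
    (hφ : IntegrableOn φ (Ico (0 : ℝ) 1)) (h0 : ∀ t, 0 ≤ φ t) :
    2 * ∫⁻ x in Ioo (0 : ℝ) 1, kernelAvg (fun t => ENNReal.ofReal (φ t)) x ^ p *
        ∫⁻ r in Ioo x 1, ENNReal.ofReal (ω r) ≤
      ENNReal.ofReal (2 * Real.pi) ^ p *
      ∫⁻ z, ‖hilbertOp (fun t => (φ t : ℂ)) z‖ₑ ^ p * ENNReal.ofReal (ω ‖z‖) ∂areaMeasure := by
  have hm : Measurable (kernelAvg fun t => ENNReal.ofReal (φ t)) :=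
    measurable_kernelAvg hφ.aestronglyMeasurable.aemeasurable.ennreal_ofReal
  have h := lintegral_polar_weight hω (Φ := fun x => kernelAvg (fun t => ENNReal.ofReal (φ t)) x ^ p)
    (by fun_prop)
  rw [lintegral_bergman_eq, ← h, mul_left_comm,
    ← lintegral_const_mul' (ENNReal.ofReal (2 * Real.pi) ^ p) _ (ENNReal.rpow_ne_top_of_nonneg hp.le ENNReal.ofReal_ne_top)]
  gcongr ENNReal.ofReal Real.pi⁻¹ * ?_
  refine setLIntegral_mono' (measurableSet_Ioo.prod measurableSet_Ioo) fun q hq => ?_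
  calc _ ≤ ENNReal.ofReal q.1 * ((ENNReal.ofReal (2 * Real.pi) *
        ‖hilbertOp (fun t => (φ t : ℂ)) (Complex.polarCoord.symm q)‖ₑ) ^ p *
          (Ico (0 : ℝ) 1).indicator (fun r => ENNReal.ofReal (ω r)) q.1) := by
        gcongr
        exact kernelAvg_le_enorm_hilbertOp hφ h0 hq.1 hq.2
    _ = _ := by rw [ENNReal.mul_rpow_of_nonneg _ _ hp.le]; ring

/-! ### Integrability of the weight and calculus of its primitives. -/

/-- Taking `Φ = 1` in `lintegral_polar_weight` shows that the tails of `ω` have finite integral over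
`[0,1]`. An infinite tail at `1/2` would force infinite tails for all `x < 1/2`. On `[0,1/2]`
continuity suffices. -/
theorem IsRadialWeight.integrableOn (h : IsRadialWeight ω) (hc : ContinuousOn ω (Ico (0 : ℝ) 1)) :
    IntegrableOn ω (Ico (0 : ℝ) 1) := by
  have h1 := lintegral_bergman_eq (p := 1) (ω := ω) (fun _ => 1)
  have h2 := lintegral_polar_weight hc (Φ := fun _ => 1) measurable_const
  simp only [enorm_one, ENNReal.one_rpow] at h1
  rw [h2] at h1
  simp only [one_mul] at h1
  have h3 := h.integrable.lintegral_lt_top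
  rw [h1] at h3
  have h4 : ∫⁻ x in Ioo (0 : ℝ) 1, ∫⁻ r in Ioo x 1, ENNReal.ofReal (ω r) < ∞ := by
    refine lt_of_le_of_lt ?_ h3
    exact le_mul_of_one_le_left zero_le (by norm_num)
  have h5 : ∫⁻ r in Ioo (1 / 2 : ℝ) 1, ENNReal.ofReal (ω r) < ∞ := by
    by_contra hcon
    rw [not_lt, top_le_iff] at hcon
    have : ∫⁻ x in Ioo (0 : ℝ) (1 / 2), (∞ : ℝ≥0∞) ≤
        ∫⁻ x in Ioo (0 : ℝ) 1, ∫⁻ r in Ioo x 1, ENNReal.ofReal (ω r) := by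
      refine (setLIntegral_mono' measurableSet_Ioo fun x hx => ?_).trans
        (lintegral_mono_set (Ioo_subset_Ioo_right (by norm_num)))
      rw [← hcon]
      exact lintegral_mono_set (Ioo_subset_Ioo_left hx.2.le)
    rw [setLIntegral_const, Real.volume_Ioo, ENNReal.top_mul (by norm_num)] at this
    exact absurd h4 (not_lt.2 this)
  have hsub : Ioo (1 / 2 : ℝ) 1 ⊆ Ico 0 1 := fun x hx => ⟨by linarith [hx.1], hx.2⟩
  have h6 : IntegrableOn ω (Ioo (1 / 2 : ℝ) 1) := by
    refine ⟨(hc.mono hsub).aestronglyMeasurable measurableSet_Ioo, ?_⟩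
    rw [hasFiniteIntegral_iff_ofReal]
    · exact h5
    · exact (ae_restrict_iff' measurableSet_Ioo).2
        (Filter.Eventually.of_forall fun x hx => (h.pos x (hsub hx)).le)
  have h7 : IntegrableOn ω (Icc 0 (1 / 2 : ℝ)) :=
    (hc.mono fun x hx => ⟨hx.1, by linarith [hx.2]⟩).integrableOn_Icc
  refine (h7.union h6).mono_set fun x hx => ?_
  rcases le_or_gt x (1 / 2) with hx' | hx'
  · exact Or.inl ⟨hx.1, hx'⟩
  · exact Or.inr ⟨hx', hx.2⟩

theorem ofReal_intervalIntegral {f : ℝ → ℝ} {a b : ℝ} (hab : a ≤ b) (hi : IntegrableOn f (Ico a b))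
    (h0 : ∀ x ∈ Ico a b, 0 ≤ f x) :
    ENNReal.ofReal (∫ x in a..b, f x) = ∫⁻ x in Ico a b, ENNReal.ofReal (f x) := by
  rw [intervalIntegral.integral_of_le hab, integral_Ioc_eq_integral_Ioo,
    ← integral_Ico_eq_integral_Ioo, ofReal_integral_eq_lintegral_ofReal hi]
  exact (ae_restrict_iff' measurableSet_Ico).2 (Filter.Eventually.of_forall h0)

theorem integrableOn_Icc_of_Ico {f : ℝ → ℝ} {a b : ℝ} (hi : IntegrableOn f (Ico a b)) :
    IntegrableOn f (Icc a b) := by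
  rwa [integrableOn_Icc_iff_integrableOn_Ico]

theorem continuousOn_integral_left {f : ℝ → ℝ} {a b : ℝ} (hab : a ≤ b) (hi : IntegrableOn f (Ico a b)) :
    ContinuousOn (fun x => ∫ t in x..b, f t) (Icc a b) := by
  have := intervalIntegral.continuousOn_primitive_interval_left (μ := volume) (a := a) (b := b) (f := f)
    (by rw [uIcc_of_le hab]; exact integrableOn_Icc_of_Ico hi)
  rwa [uIcc_of_le hab] at this

theorem continuousOn_integral_right {f : ℝ → ℝ} {a b : ℝ} (hab : a ≤ b) (hi : IntegrableOn f (Ico a b)) :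
    ContinuousOn (fun x => ∫ t in a..x, f t) (Icc a b) := by
  have := intervalIntegral.continuousOn_primitive_interval (μ := volume) (a := a) (b := b) (f := f)
    (by rw [uIcc_of_le hab]; exact integrableOn_Icc_of_Ico hi)
  rwa [uIcc_of_le hab] at this

theorem integral_pos_of_pos {f : ℝ → ℝ} {a b : ℝ} (hab : a < b) (hi : IntegrableOn f (Ico a b))
    (h0 : ∀ x ∈ Ico a b, 0 < f x) : 0 < ∫ x in a..b, f x := by
  refine intervalIntegral.intervalIntegral_pos_of_pos_on ?_ (fun x hx => h0 x ⟨hx.1.le, hx.2⟩) hab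
  rw [intervalIntegrable_iff_integrableOn_Ico_of_le hab.le]
  exact hi

theorem hasDerivAt_integral_left {f : ℝ → ℝ} {a b : ℝ} (hi : IntegrableOn f (Ico a b))
    (hc : ContinuousOn f (Ico a b)) {x : ℝ} (hx : x ∈ Ioo a b) :
    HasDerivAt (fun x => ∫ t in x..b, f t) (-f x) x := by
  have hn : Ico a b ∈ nhds x := Ico_mem_nhds hx.1 hx.2
  refine intervalIntegral.integral_hasDerivAt_left ?_ ?_ (hc.continuousAt hn)
  · rw [intervalIntegrable_iff_integrableOn_Ico_of_le hx.2.le]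
    exact hi.mono_set (Ico_subset_Ico_left hx.1.le)
  · exact ⟨Ico a b, hn, hi.aestronglyMeasurable⟩

theorem hasDerivAt_integral_right {f : ℝ → ℝ} {a b : ℝ} (hi : IntegrableOn f (Ico a b))
    (hc : ContinuousOn f (Ico a b)) {x : ℝ} (hx : x ∈ Ioo a b) :
    HasDerivAt (fun x => ∫ t in a..x, f t) (f x) x := by
  have hn : Ico a b ∈ nhds x := Ico_mem_nhds hx.1 hx.2
  refine intervalIntegral.integral_hasDerivAt_right ?_ ?_ (hc.continuousAt hn)
  · rw [intervalIntegrable_iff_integrableOn_Ico_of_le hx.1.le]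
    exact hi.mono_set (Ico_subset_Ico_right hx.2.le)
  · exact ⟨Ico a b, hn, hi.aestronglyMeasurable⟩

/-- The integrand is the derivative of `-α⁻¹ (∫_x^b f)^α`, and `α > 0` kills the boundary term at
`b`. This and its head version evaluate the Schur integrals in `hardy_tail`. -/
theorem lintegral_mul_tail_rpow {f : ℝ → ℝ} {a b : ℝ} (hab : a < b) (hi : IntegrableOn f (Ico a b))
    (hc : ContinuousOn f (Ico a b)) (h0 : ∀ x ∈ Ico a b, 0 < f x) {α : ℝ} (hα : 0 < α) :
    ∫⁻ x in Ioo a b, ENNReal.ofReal (f x * (∫ t in x..b, f t) ^ (α - 1)) =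
      ENNReal.ofReal (α⁻¹ * (∫ t in a..b, f t) ^ α) := by
  have hpos : ∀ x ∈ Ico a b, 0 < ∫ t in x..b, f t := fun x hx =>
    integral_pos_of_pos hx.2 (hi.mono_set (Ico_subset_Ico_left hx.1))
      fun y hy => h0 y ⟨hx.1.trans hy.1, hy.2⟩
  rw [lintegral_deriv_eq_of_nonneg hab.le (Φ := fun x => -(α⁻¹ * (∫ t in x..b, f t) ^ α))]
  · simp [Real.zero_rpow hα.ne']
  · exact (((continuousOn_integral_left hab.le hi).rpow_const fun _ _ => Or.inr hα.le).const_mul _).neg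
  · intro x hx
    have := (((hasDerivAt_integral_left hi hc hx).rpow_const (p := α)
      (Or.inl (hpos x ⟨hx.1.le, hx.2⟩).ne')).const_mul α⁻¹).neg
    exact this.congr_deriv (by field_simp)
  · intro x hx
    exact mul_nonneg (h0 x ⟨hx.1.le, hx.2⟩).le (Real.rpow_nonneg (hpos x ⟨hx.1.le, hx.2⟩).le _)

theorem lintegral_mul_head_rpow {f : ℝ → ℝ} {a b : ℝ} (hab : a < b) (hi : IntegrableOn f (Ico a b))
    (hc : ContinuousOn f (Ico a b)) (h0 : ∀ x ∈ Ico a b, 0 < f x) {α : ℝ} (hα : 0 < α) :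
    ∫⁻ x in Ioo a b, ENNReal.ofReal (f x * (∫ t in a..x, f t) ^ (α - 1)) =
      ENNReal.ofReal (α⁻¹ * (∫ t in a..b, f t) ^ α) := by
  have hpos : ∀ x ∈ Ioo a b, 0 < ∫ t in a..x, f t := fun x hx =>
    integral_pos_of_pos hx.1 (hi.mono_set (Ico_subset_Ico_right hx.2.le))
      fun y hy => h0 y ⟨hy.1, hy.2.trans hx.2⟩
  rw [lintegral_deriv_eq_of_nonneg hab.le (Φ := fun x => α⁻¹ * (∫ t in a..x, f t) ^ α)]
  · simp [Real.zero_rpow hα.ne']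
  · exact ((continuousOn_integral_right hab.le hi).rpow_const fun _ _ => Or.inr hα.le).const_mul _
  · intro x hx
    have := ((hasDerivAt_integral_right hi hc hx).rpow_const (p := α)
      (Or.inl (hpos x hx).ne')).const_mul α⁻¹
    exact this.congr_deriv (by field_simp)
  · intro x hx
    exact mul_nonneg (h0 x ⟨hx.1.le, hx.2⟩).le (Real.rpow_nonneg (hpos x hx).le _)

/-! ### Hardy inequalities for decreasing weights. -/

/-- The properties of the tail integral of a radial weight that govern the Hilbert operator. -/
structure IsTailWeight (w : ℝ → ℝ) : Prop where
  pos : ∀ x ∈ Ico (0 : ℝ) 1, 0 < w x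
  anti : AntitoneOn w (Ico (0 : ℝ) 1)
  cont : ContinuousOn w (Ico (0 : ℝ) 1)

theorem IsRadialWeight.ofReal_hat (h : IsRadialWeight ω) (hc : ContinuousOn ω (Ico (0 : ℝ) 1))
    {x : ℝ} (hx : x ∈ Ico (0 : ℝ) 1) :
    ENNReal.ofReal (hat ω x) = ∫⁻ r in Ioo x 1, ENNReal.ofReal (ω r) := by
  rw [hat, ofReal_intervalIntegral hx.2.le ((h.integrableOn hc).mono_set (Ico_subset_Ico_left hx.1))
    fun y hy => (h.pos y ⟨hx.1.trans hy.1, hy.2⟩).le, setLIntegral_congr Ioo_ae_eq_Ico]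

theorem IsRadialWeight.isTailWeight_hat (h : IsRadialWeight ω)
    (hc : ContinuousOn ω (Ico (0 : ℝ) 1)) : IsTailWeight (hat ω) where
  pos x hx := integral_pos_of_pos hx.2 ((h.integrableOn hc).mono_set (Ico_subset_Ico_left hx.1))
    fun y hy => h.pos y ⟨hx.1.trans hy.1, hy.2⟩
  anti x hx y hy hxy := by
    have hpos : 0 < hat ω x :=
      integral_pos_of_pos hx.2 ((h.integrableOn hc).mono_set (Ico_subset_Ico_left hx.1))
        fun y hy => h.pos y ⟨hx.1.trans hy.1, hy.2⟩
    rw [← ENNReal.ofReal_le_ofReal_iff hpos.le, h.ofReal_hat hc hx, h.ofReal_hat hc hy]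
    exact lintegral_mono_set (Ioo_subset_Ioo_left hxy)
  cont := (continuousOn_integral_left zero_le_one (h.integrableOn hc)).mono Ico_subset_Icc_self

theorem IsTailWeight.aemeasurable (hw : IsTailWeight w) :
    AEMeasurable w (volume.restrict (Ioo (0 : ℝ) 1)) :=
  (hw.cont.mono Ioo_subset_Ico_self).aemeasurable measurableSet_Ioo

theorem lintegral_one_sub_rpow_head {σ x : ℝ} (hσ : 0 < σ) (hx0 : 0 ≤ x) (hx : x < 1) :
    ∫⁻ t in Ioo 0 x, ENNReal.ofReal ((1 - t) ^ (-σ - 1)) ≤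
      ENNReal.ofReal (σ⁻¹ * (1 - x) ^ (-σ)) := by
  rw [lintegral_deriv_eq_of_nonneg hx0 (Φ := fun t => σ⁻¹ * (1 - t) ^ (-σ))]
  · apply ENNReal.ofReal_le_ofReal
    simp only [sub_zero, Real.one_rpow, mul_one, sub_le_self_iff]
    positivity
  · refine ContinuousOn.const_mul (ContinuousOn.rpow_const (by fun_prop) fun t ht => Or.inl ?_) _
    linarith [ht.2]
  · intro t ht
    have := (((hasDerivAt_id t).const_sub 1).rpow_const (p := -σ)
      (Or.inl (by simp only [id]; linarith [ht.2]))).const_mul σ⁻¹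
    simp only [id] at this
    exact this.congr_deriv (by field_simp)
  · intro t ht
    exact Real.rpow_nonneg (by linarith [ht.2]) _

theorem lintegral_one_sub_rpow_tail {α t : ℝ} (hα : 0 < α) (ht : t ≤ 1) :
    ∫⁻ x in Ioo t 1, ENNReal.ofReal ((1 - x) ^ (α - 1)) = ENNReal.ofReal (α⁻¹ * (1 - t) ^ α) := by
  rw [lintegral_deriv_eq_of_nonneg ht (Φ := fun x => -(α⁻¹ * (1 - x) ^ α))]
  · simp [Real.zero_rpow hα.ne']
  · exact (ContinuousOn.const_mul (ContinuousOn.rpow_const (by fun_prop) fun t ht => Or.inr hα.le) _).neg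
  · intro x hx
    have := ((((hasDerivAt_id x).const_sub 1).rpow_const (p := α)
      (Or.inl (by simp only [id]; linarith [hx.2]))).const_mul α⁻¹).neg
    simp only [id] at this
    exact this.congr_deriv (by field_simp)
  · intro x hx
    exact Real.rpow_nonneg (by linarith [hx.2]) _

/-- A Hardy inequality for the averages `∫_0^x g(t) / (1 - t) dt` with a decreasing weight. -/
theorem hardy_head (hp : 1 < p) (hw : IsTailWeight w) {g : ℝ → ℝ≥0∞}
    (hg : AEMeasurable g (volume.restrict (Ioo (0 : ℝ) 1))) :
    ∫⁻ x in Ioo (0 : ℝ) 1, (∫⁻ t in Ioo (0 : ℝ) 1,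
        stepKernel t x * ENNReal.ofReal (1 - t)⁻¹ * g t) ^ p * ENNReal.ofReal (w x) ≤
      ENNReal.ofReal (2 * (p - 1)) ^ (p - 1) * 2 *
        ∫⁻ t in Ioo (0 : ℝ) 1, g t ^ p * ENNReal.ofReal (w t) := by
  have hp1 : 0 < p - 1 := by linarith
  -- Any `σ` in `(0, 1/(p-1))` would serve: `(1-t)^(-σ-1)` integrates to at most `σ⁻¹ (1-x)^(-σ)`,
  -- while `(1-x)^(-σ(p-1))` stays integrable at `1`. This choice makes the latter exponent `-1/2`.
  set σ : ℝ := 1 / (2 * (p - 1)) with hσ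
  have hσ0 : 0 < σ := by positivity
  refine lintegral_rpow_kernel_le hp
    (k := fun x t => stepKernel t x * ENNReal.ofReal (1 - t)⁻¹)
    (Q := fun t => ENNReal.ofReal ((1 - t) ^ (-σ))) (P := fun t => ENNReal.ofReal ((1 - t) ^ (-σ)))
    ((measurable_stepKernel.comp measurable_swap).mul (by fun_prop)) hg (by fun_prop) (by fun_prop)
    hw.aemeasurable.ennreal_ofReal ?_ ENNReal.ofReal_ne_top (by norm_num) ?_ ?_
  · refine (ae_restrict_iff' measurableSet_Ioo).2 (Filter.Eventually.of_forall fun t ht => ?_)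
    have : 0 < 1 - t := by linarith [ht.2]
    exact ⟨(ENNReal.ofReal_pos.2 (by positivity)).ne', ENNReal.ofReal_ne_top⟩
  · refine (ae_restrict_iff' measurableSet_Ioo).2 (Filter.Eventually.of_forall fun x hx => ?_)
    simp only [mul_assoc]
    rw [lintegral_stepKernel_left hx.2.le]
    calc _ = ∫⁻ t in Ioo 0 x, ENNReal.ofReal ((1 - t) ^ (-σ - 1)) := by
          refine setLIntegral_congr_fun measurableSet_Ioo fun t ht => ?_
          have h1 : 0 < 1 - t := by linarith [ht.2, hx.2]
          rw [← ENNReal.ofReal_mul (by positivity), Real.rpow_sub_one h1.ne', div_eq_inv_mul]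
      _ ≤ _ := lintegral_one_sub_rpow_head hσ0 hx.1.le hx.2
      _ = _ := by rw [ENNReal.ofReal_mul (by positivity), hσ]; simp
  · refine (ae_restrict_iff' measurableSet_Ioo).2 (Filter.Eventually.of_forall fun t ht => ?_)
    have ht1 : 0 < 1 - t := by linarith [ht.2]
    simp only [mul_assoc]
    rw [lintegral_stepKernel_right ht.1.le (fun x => ENNReal.ofReal (1 - t)⁻¹ *
      (ENNReal.ofReal ((1 - x) ^ (-σ)) ^ (p - 1) * ENNReal.ofReal (w x)))]
    have hwt := (hw.pos t ⟨ht.1.le, ht.2⟩).le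
    have hQ : ENNReal.ofReal ((1 - t) ^ (-σ)) ^ (1 - p) = ENNReal.ofReal ((1 - t) ^ (1 / 2 : ℝ)) := by
      rw [ENNReal.ofReal_rpow_of_pos (by positivity), ← Real.rpow_mul ht1.le,
        show -σ * (1 - p) = 1 / 2 by rw [hσ]; field_simp; ring]
    calc _ ≤ (∫⁻ x in Ioo t 1, ENNReal.ofReal (1 - t)⁻¹ * ENNReal.ofReal (w t) *
          ENNReal.ofReal ((1 - x) ^ ((1 / 2 : ℝ) - 1))) * ENNReal.ofReal ((1 - t) ^ (-σ)) ^ (1 - p) := by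
          gcongr ?_ * _
          refine setLIntegral_mono' measurableSet_Ioo fun x hx => ?_
          have hx1 : 0 < 1 - x := by linarith [hx.2]
          rw [ENNReal.ofReal_rpow_of_pos (by positivity), ← Real.rpow_mul hx1.le,
            show -σ * (p - 1) = 1 / 2 - 1 by rw [hσ]; field_simp; ring, mul_assoc,
            mul_comm (ENNReal.ofReal (w t))]
          gcongr
          exact hw.anti ⟨ht.1.le, ht.2⟩ ⟨(ht.1.trans hx.1).le, hx.2⟩ hx.1.le
      _ = ENNReal.ofReal ((1 - t)⁻¹ * w t * ((1 / 2 : ℝ)⁻¹ * (1 - t) ^ (1 / 2 : ℝ)) *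
            (1 - t) ^ (1 / 2 : ℝ)) := by
          rw [lintegral_const_mul' _ _ (ENNReal.mul_ne_top ENNReal.ofReal_ne_top ENNReal.ofReal_ne_top),
            lintegral_one_sub_rpow_tail (by norm_num) ht.2.le, hQ,
            ← ENNReal.ofReal_mul (inv_nonneg.2 ht1.le), ← ENNReal.ofReal_mul (by positivity),
            ← ENNReal.ofReal_mul (by positivity)]
      _ = ENNReal.ofReal (2 * w t) := by
          congr 1
          have : (1 - t) ^ (1 / 2 : ℝ) * (1 - t) ^ (1 / 2 : ℝ) = 1 - t := by
            rw [← Real.rpow_add ht1]; norm_num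
          calc _ = 2 * w t * ((1 - t)⁻¹ * ((1 - t) ^ (1 / 2 : ℝ) * (1 - t) ^ (1 / 2 : ℝ))) := by
                ring
            _ = _ := by rw [this, inv_mul_cancel₀ ht1.ne', mul_one]
      _ = _ := by rw [ENNReal.ofReal_mul (by norm_num), ENNReal.ofReal_ofNat]
      _ ≤ _ := le_rfl

theorem IsTailWeight.dual_pos (hw : IsTailWeight w) (β : ℝ) {x : ℝ} (hx : x ∈ Ico (0 : ℝ) 1) :
    0 < w x ^ β := Real.rpow_pos_of_pos (hw.pos x hx) _

theorem IsTailWeight.dual_cont (hw : IsTailWeight w) (β : ℝ) :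
    ContinuousOn (fun t => w t ^ β) (Ico (0 : ℝ) 1) :=
  hw.cont.rpow_const fun x hx => Or.inl (hw.pos x hx).ne'

theorem IsTailWeight.cont_one_sub_rpow (hw : IsTailWeight w) (β : ℝ) :
    ContinuousOn (fun t => (1 - t) ^ β * w t) (Ico (0 : ℝ) 1) :=
  (ContinuousOn.rpow_const (by fun_prop) fun x hx => Or.inl (by linarith [hx.2])).mul hw.cont

theorem IsTailWeight.integrable_one_sub_rpow (hw : IsTailWeight w) (β : ℝ) {r : ℝ} (hr : r < 1) :
    IntegrableOn (fun t => (1 - t) ^ β * w t) (Ico 0 r) :=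
  (((hw.cont_one_sub_rpow β).mono fun x (hx : x ∈ Icc 0 r) => ⟨hx.1, hx.2.trans_lt hr⟩).integrableOn_Icc
    ).mono_set Ico_subset_Icc_self

/-- Muckenhoupt's weighted Hardy inequality for the tail integrals `∫_x^1 g(t) dt`. -/
theorem hardy_tail (hp : 1 < p) (hw : IsTailWeight w)
    (hv : IntegrableOn (fun t => w t ^ (-(1 / (p - 1)))) (Ico (0 : ℝ) 1)) {m : ℝ} (hm : 0 ≤ m)
    (hM : ∀ r ∈ Ico (0 : ℝ) 1, (∫ t in r..1, w t ^ (-(1 / (p - 1)))) ^ (1 - 1 / p) *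
      (∫ t in 0..r, (1 - t) ^ (-p) * w t) ^ (1 / p) ≤ m) {g : ℝ → ℝ≥0∞}
    (hg : AEMeasurable g (volume.restrict (Ioo (0 : ℝ) 1))) :
    ∫⁻ x in Ioo (0 : ℝ) 1, (∫⁻ t in Ioo (0 : ℝ) 1, stepKernel x t * g t) ^ p *
        ENNReal.ofReal ((1 - x) ^ (-p) * w x) ≤
      ENNReal.ofReal (1 - 1 / p)⁻¹ ^ (p - 1) * ENNReal.ofReal (p * m ^ p) *
        ∫⁻ t in Ioo (0 : ℝ) 1, g t ^ p * ENNReal.ofReal (w t) := by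
  have hp0 : 0 < p := by linarith
  have hp1 : 0 < p - 1 := by linarith
  set v : ℝ → ℝ := fun t => w t ^ (-(1 / (p - 1))) with hvdef
  set H : ℝ → ℝ := fun x => ∫ t in x..1, v t with hH
  set U : ℝ → ℝ := fun t => (1 - t) ^ (-p) * w t with hU
  set J : ℝ → ℝ := fun x => ∫ t in 0..x, U t with hJ
  set α : ℝ := 1 - 1 / p with hα
  have hα0 : 0 < α := by
    rw [hα, sub_pos, div_lt_one hp0]; exact hp
  have hαp : α = (p - 1) / p := by rw [hα]; field_simp
  have hsub : Ioo (0 : ℝ) 1 ⊆ Icc 0 1 := Ioo_subset_Icc_self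
  have hvpos : ∀ x ∈ Ico (0 : ℝ) 1, 0 < v x := fun x hx => hw.dual_pos _ hx
  have hvc : ContinuousOn v (Ico (0 : ℝ) 1) := hw.dual_cont _
  have hHpos : ∀ x ∈ Ico (0 : ℝ) 1, 0 < H x := fun x hx =>
    integral_pos_of_pos hx.2 (hv.mono_set (Ico_subset_Ico_left hx.1))
      fun y hy => hvpos y ⟨hx.1.trans hy.1, hy.2⟩
  have hHc : ContinuousOn H (Icc 0 1) := continuousOn_integral_left zero_le_one hv
  have hHm : AEMeasurable H (volume.restrict (Ioo (0 : ℝ) 1)) :=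
    (hHc.mono hsub).aemeasurable measurableSet_Ioo
  have hUpos : ∀ x ∈ Ico (0 : ℝ) 1, 0 < U x := fun x hx =>
    mul_pos (Real.rpow_pos_of_pos (by linarith [hx.2]) _) (hw.pos x hx)
  have hUc : ContinuousOn U (Ico (0 : ℝ) 1) := hw.cont_one_sub_rpow _
  have hUi : ∀ r < 1, IntegrableOn U (Ico 0 r) := fun r hr => hw.integrable_one_sub_rpow _ hr
  have hJpos : ∀ x ∈ Ioo (0 : ℝ) 1, 0 < J x := fun x hx =>
    integral_pos_of_pos hx.1 (hUi x hx.2) fun y hy => hUpos y ⟨hy.1, hy.2.trans hx.2⟩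
  -- With `α - 1 = -1/p`, the tail integral of `Q = v H^(α-1)` is `α⁻¹ H^α`, so the first Schur
  -- condition is an equality. Also `Q^(1-p) = w H^α`, because `v^(1-p) = w`.
  refine lintegral_rpow_kernel_le hp (k := stepKernel)
    (Q := fun t => ENNReal.ofReal (v t * H t ^ (α - 1))) (P := fun t => ENNReal.ofReal (H t ^ α))
    measurable_stepKernel hg ?_ (hHm.pow_const _).ennreal_ofReal
    ((hUc.mono Ioo_subset_Ico_self).aemeasurable measurableSet_Ioo).ennreal_ofReal
    ?_ ENNReal.ofReal_ne_top ENNReal.ofReal_ne_top ?_ ?_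
  · exact (((hvc.mono Ioo_subset_Ico_self).aemeasurable measurableSet_Ioo).mul
      (hHm.pow_const _)).ennreal_ofReal
  · refine (ae_restrict_iff' measurableSet_Ioo).2 (Filter.Eventually.of_forall fun t ht => ?_)
    have h1 := hHpos t ⟨ht.1.le, ht.2⟩
    have h2 := hvpos t ⟨ht.1.le, ht.2⟩
    exact ⟨(ENNReal.ofReal_pos.2 (by positivity)).ne', ENNReal.ofReal_ne_top⟩
  · refine (ae_restrict_iff' measurableSet_Ioo).2 (Filter.Eventually.of_forall fun x hx => ?_)
    have hs : Ico x 1 ⊆ Ico 0 1 := Ico_subset_Ico_left hx.1.le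
    rw [lintegral_stepKernel_right hx.1.le, lintegral_mul_tail_rpow hx.2 (hv.mono_set hs)
      (hvc.mono hs) (fun y hy => hvpos y (hs hy)) hα0, ENNReal.ofReal_mul (by positivity)]
  · refine (ae_restrict_iff' measurableSet_Ioo).2 (Filter.Eventually.of_forall fun t ht => ?_)
    have ht' : t ∈ Ico (0 : ℝ) 1 := ⟨ht.1.le, ht.2⟩
    have hs : Ico 0 t ⊆ Ico (0 : ℝ) 1 := Ico_subset_Ico_right ht.2.le
    have hwt := hw.pos t ht'
    have hHt := hHpos t ht'
    have hJt := hJpos t ht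
    rw [lintegral_stepKernel_left ht.2.le (fun x => ENNReal.ofReal (H x ^ α) ^ (p - 1) *
      ENNReal.ofReal (U x))]
    have hQ : ENNReal.ofReal (v t * H t ^ (α - 1)) ^ (1 - p) = ENNReal.ofReal (w t * H t ^ α) := by
      have hvt := hvpos t ht'
      rw [ENNReal.ofReal_rpow_of_pos (by positivity), Real.mul_rpow hvt.le (by positivity),
        ← Real.rpow_mul hHt.le, hvdef, ← Real.rpow_mul hwt.le,
        show -(1 / (p - 1)) * (1 - p) = 1 by field_simp; ring, Real.rpow_one,
        show (α - 1) * (1 - p) = α by rw [hα]; field_simp; ring]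
    -- First use of `hM`, at each `x < t`: it replaces `H^(α(p-1))` by `m^(p-1) J^(1/p-1)`, and `U
    -- J^(1/p-1)` is the derivative of `p J^(1/p)`.
    have hhead : ∫⁻ x in Ioo 0 t, ENNReal.ofReal (H x ^ α) ^ (p - 1) * ENNReal.ofReal (U x) ≤
        ENNReal.ofReal (m ^ (p - 1) * (p * J t ^ (1 / p))) := by
      calc _ ≤ ∫⁻ x in Ioo 0 t, ENNReal.ofReal (m ^ (p - 1)) *
            ENNReal.ofReal (U x * J x ^ (1 / p - 1)) := by
            refine setLIntegral_mono' measurableSet_Ioo fun x hx => ?_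
            have hx' : x ∈ Ico (0 : ℝ) 1 := ⟨hx.1.le, hx.2.trans ht.2⟩
            have hHx := hHpos x hx'
            have hJx := hJpos x ⟨hx.1, hx'.2⟩
            have hUx := hUpos x hx'
            rw [ENNReal.ofReal_rpow_of_pos (by positivity), ← ENNReal.ofReal_mul (by positivity),
              ← ENNReal.ofReal_mul (by positivity)]
            apply ENNReal.ofReal_le_ofReal
            have h1 : (H x ^ α * J x ^ (1 / p)) ^ (p - 1) ≤ m ^ (p - 1) :=
              Real.rpow_le_rpow (by positivity) (hM x hx') hp1.le
            rw [Real.mul_rpow (by positivity) (by positivity), ← Real.rpow_mul hJx.le] at h1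
            have h2 : J x ^ (1 / p * (p - 1)) * J x ^ (1 / p - 1) = 1 := by
              rw [← Real.rpow_add hJx, show 1 / p * (p - 1) + (1 / p - 1) = 0 by field_simp; ring,
                Real.rpow_zero]
            calc (H x ^ α) ^ (p - 1) * U x
                = (H x ^ α) ^ (p - 1) * (J x ^ (1 / p * (p - 1)) * J x ^ (1 / p - 1)) * U x := by
                  rw [h2, mul_one]
              _ = ((H x ^ α) ^ (p - 1) * J x ^ (1 / p * (p - 1))) * (U x * J x ^ (1 / p - 1)) := by
                  ring
              _ ≤ _ := by gcongr
        _ = _ := by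
            rw [lintegral_const_mul' _ _ ENNReal.ofReal_ne_top, lintegral_mul_head_rpow ht.1
              (hUi t ht.2) (hUc.mono hs) (fun y hy => hUpos y (hs hy)) (by positivity),
              ← ENNReal.ofReal_mul (by positivity)]
            simp only [one_div, inv_inv]
            rfl
    calc _ ≤ ENNReal.ofReal (m ^ (p - 1) * (p * J t ^ (1 / p))) * ENNReal.ofReal (w t * H t ^ α) := by
          rw [hQ]; gcongr
      _ = ENNReal.ofReal (p * (m ^ (p - 1) * (H t ^ α * J t ^ (1 / p))) * w t) := by
          rw [← ENNReal.ofReal_mul (by positivity)]; congr 1; ring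
      -- Second use of `hM`, now at `t`, which completes the power `m^p`.
      _ ≤ ENNReal.ofReal (p * (m ^ (p - 1) * m) * w t) := by
          gcongr; exact hM t ht'
      _ = _ := by
          rw [← ENNReal.ofReal_mul (by positivity)]
          congr 3
          conv_lhs => rw [← Real.rpow_one m, ← Real.rpow_mul hm]
          rw [← Real.rpow_add_of_nonneg hm (by linarith) zero_le_one]
          congr 1; ring

/-! ### The upper bound for the operator norms. -/

/-- `1 - t x` is at least both `1 - t` and `1 - x`; on each side of `x` the larger of the two is
used. -/
theorem kernelAvg_le_add (g : ℝ → ℝ≥0∞) {x : ℝ} (hx : x ∈ Ioo (0 : ℝ) 1)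
    (hg : AEMeasurable g (volume.restrict (Ioo (0 : ℝ) 1))) :
    kernelAvg g x ≤ (∫⁻ t in Ioo (0 : ℝ) 1, stepKernel t x * ENNReal.ofReal (1 - t)⁻¹ * g t) +
      ENNReal.ofReal (1 - x)⁻¹ * ∫⁻ t in Ioo (0 : ℝ) 1, stepKernel x t * g t := by
  rw [kernelAvg, ← setLIntegral_congr Ioo_ae_eq_Ico, ← lintegral_const_mul' _ _ ENNReal.ofReal_ne_top,
    ← lintegral_add_right']
  · have hne : ∀ᵐ t ∂(volume.restrict (Ioo (0 : ℝ) 1)), t ≠ x :=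
      ae_restrict_of_ae (compl_mem_ae_iff.2 (measure_singleton x))
    refine lintegral_mono_ae ?_
    filter_upwards [hne, ae_restrict_mem measurableSet_Ioo] with t htx ht
    rcases lt_or_gt_of_ne htx with h | h
    · have h1 : stepKernel t x = 1 := by simp [stepKernel, h]
      have h2 : stepKernel x t = 0 := by simp [stepKernel, h.le]
      rw [h1, h2, one_mul, zero_mul, mul_zero, add_zero, mul_comm]
      gcongr
      · linarith [ht.2]
      · nlinarith [ht.1, hx.2]
    · have h1 : stepKernel t x = 0 := by simp [stepKernel, h.le]
      have h2 : stepKernel x t = 1 := by simp [stepKernel, h]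
      rw [h1, h2, one_mul, zero_mul, zero_mul, zero_add, mul_comm]
      gcongr
      · linarith [hx.2]
      · nlinarith [ht.2, hx.1]
  · have : Measurable fun t => stepKernel x t := measurable_stepKernel.of_uncurry_left
    exact (this.aemeasurable.mul hg).const_mul _

theorem lintegral_kernelAvg_rpow_le (hp : 1 < p) (hw : IsTailWeight w)
    (hv : IntegrableOn (fun t => w t ^ (-(1 / (p - 1)))) (Ico (0 : ℝ) 1)) {m : ℝ} (hm : 1 / 2 ≤ m)
    (hM : ∀ r ∈ Ico (0 : ℝ) 1, (∫ t in r..1, w t ^ (-(1 / (p - 1)))) ^ (1 - 1 / p) *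
      (∫ t in 0..r, (1 - t) ^ (-p) * w t) ^ (1 / p) ≤ m) {g : ℝ → ℝ≥0∞}
    (hg : AEMeasurable g (volume.restrict (Ioo (0 : ℝ) 1))) :
    ∫⁻ x in Ioo (0 : ℝ) 1, kernelAvg g x ^ p * ENNReal.ofReal (w x) ≤
      2 ^ (p - 1) * (ENNReal.ofReal (2 * (p - 1)) ^ (p - 1) * 2 * 2 ^ p +
        ENNReal.ofReal (1 - 1 / p)⁻¹ ^ (p - 1) * ENNReal.ofReal p) * ENNReal.ofReal m ^ p *
        ∫⁻ t in Ioo (0 : ℝ) 1, g t ^ p * ENNReal.ofReal (w t) := by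
  have hp0 : 0 < p := by linarith
  have hm0 : 0 < m := by linarith
  set N := ∫⁻ t in Ioo (0 : ℝ) 1, g t ^ p * ENNReal.ofReal (w t)
  have hb : ∀ x ∈ Ioo (0 : ℝ) 1, kernelAvg g x ^ p * ENNReal.ofReal (w x) ≤
      2 ^ (p - 1) * ((∫⁻ t in Ioo (0 : ℝ) 1,
        stepKernel t x * ENNReal.ofReal (1 - t)⁻¹ * g t) ^ p * ENNReal.ofReal (w x) +
        (∫⁻ t in Ioo (0 : ℝ) 1, stepKernel x t * g t) ^ p *
        ENNReal.ofReal ((1 - x) ^ (-p) * w x)) := by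
    intro x hx
    have hx1 : 0 < 1 - x := by linarith [hx.2]
    have h1 := (ENNReal.rpow_le_rpow (kernelAvg_le_add g hx hg) hp0.le).trans
      (ENNReal.rpow_add_le_mul_rpow_add_rpow _ _ hp.le)
    rw [ENNReal.mul_rpow_of_nonneg _ _ hp0.le, ENNReal.ofReal_rpow_of_pos (inv_pos.2 hx1),
      Real.inv_rpow hx1.le, ← Real.rpow_neg hx1.le] at h1
    rw [ENNReal.ofReal_mul (by positivity)]
    calc _ ≤ _ := mul_le_mul_left h1 _
      _ = _ := by ring
  have hmeas : AEMeasurable (fun x => (∫⁻ t in Ioo (0 : ℝ) 1, stepKernel x t * g t) ^ p *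
        ENNReal.ofReal ((1 - x) ^ (-p) * w x)) (volume.restrict (Ioo (0 : ℝ) 1)) := by
    refine (AEMeasurable.pow_const ?_ _).mul
      (((hw.cont_one_sub_rpow (-p)).mono Ioo_subset_Ico_self).aemeasurable
        measurableSet_Ioo).ennreal_ofReal
    exact (measurable_stepKernel.aemeasurable.mul hg.comp_snd).lintegral_prod_right'
  -- The head term carries no power of `m`; since `m ≥ 1/2` it may be multiplied by `(2m)^p`.
  have hone : 1 ≤ 2 ^ p * ENNReal.ofReal m ^ p := by
    rw [← ENNReal.mul_rpow_of_nonneg _ _ hp0.le]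
    refine ENNReal.one_le_rpow ?_ hp0
    rw [← ENNReal.ofReal_ofNat, ← ENNReal.ofReal_mul (by norm_num), ENNReal.one_le_ofReal]
    linarith
  calc _ ≤ _ := setLIntegral_mono' measurableSet_Ioo hb
    _ = 2 ^ (p - 1) * _ := lintegral_const_mul' _ _ (by simp)
    _ ≤ 2 ^ (p - 1) * (ENNReal.ofReal (2 * (p - 1)) ^ (p - 1) * 2 * N +
        ENNReal.ofReal (1 - 1 / p)⁻¹ ^ (p - 1) * ENNReal.ofReal (p * m ^ p) * N) := by
        rw [lintegral_add_right' _ hmeas]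
        gcongr
        · exact hardy_head hp hw hg
        · exact hardy_tail hp hw hv hm0.le hM hg
    _ ≤ 2 ^ (p - 1) * (ENNReal.ofReal (2 * (p - 1)) ^ (p - 1) * 2 * N * (2 ^ p * ENNReal.ofReal m ^ p) +
        ENNReal.ofReal (1 - 1 / p)⁻¹ ^ (p - 1) * (ENNReal.ofReal p * ENNReal.ofReal m ^ p) * N) := by
        rw [ENNReal.ofReal_mul hp0.le, ← ENNReal.ofReal_rpow_of_pos hm0]
        exact mul_le_mul_right (add_le_add (le_mul_of_one_le_right zero_le hone) le_rfl) _
    _ = _ := by ring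

/-- Take `r = 1/2` and `a = hat ω (1/2)`. By monotonicity `hat ω ≤ a` to the right and `hat ω ≥ a`
to the left, and the powers of `a` cancel. The bound is independent of `ω`, as the comparison
constants require. -/
theorem half_le_muckenhoupt (hp : 1 < p) (hw : IsTailWeight (hat ω)) :
    ENNReal.ofReal (1 / 2) ≤ muckenhoupt p ω := by
  have hp0 : 0 < p := by linarith
  have hp1 : 0 < p - 1 := by linarith
  have hα : 0 ≤ 1 - 1 / p := by
    rw [sub_nonneg, div_le_one hp0]; exact hp.le
  have hmem : (1 / 2 : ℝ) ∈ Ico (0 : ℝ) 1 := by norm_num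
  refine le_trans ?_ (le_iSup₂ (f := fun r (_ : r ∈ Ico (0 : ℝ) 1) =>
    (∫⁻ t in Ico r 1, ENNReal.ofReal (hat ω t ^ (-(1 / (p - 1))))) ^ (1 - 1 / p) *
      (∫⁻ t in Ico 0 r, ENNReal.ofReal ((1 - t) ^ (-p) * hat ω t)) ^ (1 / p)) (1 / 2) hmem)
  set a := hat ω (1 / 2) with ha
  have ha0 : 0 < a := hw.pos _ hmem
  have h1 : ENNReal.ofReal (a ^ (-(1 / (p - 1))) * (1 / 2)) ≤
      ∫⁻ t in Ico (1 / 2 : ℝ) 1, ENNReal.ofReal (hat ω t ^ (-(1 / (p - 1)))) := by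
    calc _ = ∫⁻ t in Ico (1 / 2 : ℝ) 1, ENNReal.ofReal (a ^ (-(1 / (p - 1)))) := by
          rw [setLIntegral_const, Real.volume_Ico, ENNReal.ofReal_mul (by positivity)]; norm_num
      _ ≤ _ := by
          refine setLIntegral_mono' measurableSet_Ico fun t ht => ENNReal.ofReal_le_ofReal ?_
          have ht' : t ∈ Ico (0 : ℝ) 1 := ⟨by linarith [ht.1], ht.2⟩
          exact Real.rpow_le_rpow_of_nonpos (hw.pos t ht') (hw.anti hmem ht' ht.1)
            (by rw [neg_nonpos]; positivity)
  have h2 : ENNReal.ofReal (a * (1 / 2)) ≤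
      ∫⁻ t in Ico 0 (1 / 2 : ℝ), ENNReal.ofReal ((1 - t) ^ (-p) * hat ω t) := by
    calc _ = ∫⁻ t in Ico 0 (1 / 2 : ℝ), ENNReal.ofReal a := by
          rw [setLIntegral_const, Real.volume_Ico, ENNReal.ofReal_mul (by positivity)]; norm_num
      _ ≤ _ := by
          refine setLIntegral_mono' measurableSet_Ico fun t ht => ENNReal.ofReal_le_ofReal ?_
          have ht' : t ∈ Ico (0 : ℝ) 1 := ⟨ht.1, by linarith [ht.2]⟩
          have h3 : 1 ≤ (1 - t) ^ (-p) :=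
            Real.one_le_rpow_of_pos_of_le_one_of_nonpos (by linarith [ht.2]) (by linarith [ht.1])
              (by linarith)
          have h4 := hw.anti ht' hmem ht.2.le
          exact h4.trans (le_mul_of_one_le_left (ha0.le.trans h4) h3)
  calc ENNReal.ofReal (1 / 2) = ENNReal.ofReal (a ^ (-(1 / (p - 1))) * (1 / 2)) ^ (1 - 1 / p) *
        ENNReal.ofReal (a * (1 / 2)) ^ (1 / p) := by
        rw [ENNReal.ofReal_rpow_of_pos (by positivity), ENNReal.ofReal_rpow_of_pos (by positivity),
          ← ENNReal.ofReal_mul (by positivity)]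
        congr 1
        rw [Real.mul_rpow (by positivity) (by positivity), Real.mul_rpow (by positivity) (by positivity),
          ← Real.rpow_mul ha0.le, show -(1 / (p - 1)) * (1 - 1 / p) = -(1 / p) by
            field_simp]
        have e1 : a ^ (-(1 / p)) * a ^ (1 / p) = 1 := by
          rw [← Real.rpow_add ha0, neg_add_cancel, Real.rpow_zero]
        have e2 : (1 / 2 : ℝ) ^ (1 - 1 / p) * (1 / 2 : ℝ) ^ (1 / p) = 1 / 2 := by
          rw [← Real.rpow_add (by norm_num), sub_add_cancel, Real.rpow_one]
        calc (1 / 2 : ℝ) = 1 * (1 / 2) := by ring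
          _ = (a ^ (-(1 / p)) * a ^ (1 / p)) *
              ((1 / 2 : ℝ) ^ (1 - 1 / p) * (1 / 2 : ℝ) ^ (1 / p)) := by rw [e1, e2]
          _ = _ := by ring
    _ ≤ _ := by gcongr

theorem muckenhoupt_term_eq (hp : 1 < p) (hw : IsTailWeight w)
    (hv : IntegrableOn (fun t => w t ^ (-(1 / (p - 1)))) (Ico (0 : ℝ) 1)) {r : ℝ}
    (hr : r ∈ Ico (0 : ℝ) 1) :
    (∫⁻ t in Ico r 1, ENNReal.ofReal (w t ^ (-(1 / (p - 1))))) ^ (1 - 1 / p) *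
      (∫⁻ t in Ico 0 r, ENNReal.ofReal ((1 - t) ^ (-p) * w t)) ^ (1 / p) =
    ENNReal.ofReal ((∫ t in r..1, w t ^ (-(1 / (p - 1)))) ^ (1 - 1 / p) *
      (∫ t in 0..r, (1 - t) ^ (-p) * w t) ^ (1 / p)) := by
  have hp0 : 0 < p := by linarith
  have hα : 0 ≤ 1 - 1 / p := by
    rw [sub_nonneg, div_le_one hp0]; exact hp.le
  have h1 : ∀ t ∈ Ico r 1, 0 ≤ w t ^ (-(1 / (p - 1))) := fun t ht =>
    (hw.dual_pos _ ⟨hr.1.trans ht.1, ht.2⟩).le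
  have h2 : ∀ t ∈ Ico 0 r, 0 ≤ (1 - t) ^ (-p) * w t := fun t ht =>
    mul_nonneg (Real.rpow_nonneg (by linarith [ht.2, hr.2]) _) (hw.pos t ⟨ht.1, ht.2.trans hr.2⟩).le
  have hH : 0 ≤ ∫ t in r..1, w t ^ (-(1 / (p - 1))) := by
    rw [intervalIntegral.integral_of_le hr.2.le, integral_Ioc_eq_integral_Ioo,
      ← integral_Ico_eq_integral_Ioo]
    exact setIntegral_nonneg measurableSet_Ico h1
  have hJ : 0 ≤ ∫ t in 0..r, (1 - t) ^ (-p) * w t := by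
    rw [intervalIntegral.integral_of_le hr.1, integral_Ioc_eq_integral_Ioo,
      ← integral_Ico_eq_integral_Ioo]
    exact setIntegral_nonneg measurableSet_Ico h2
  rw [← ofReal_intervalIntegral hr.2.le (hv.mono_set (Ico_subset_Ico_left hr.1)) h1,
    ← ofReal_intervalIntegral hr.1 (hw.integrable_one_sub_rpow _ hr.2) h2,
    ENNReal.ofReal_rpow_of_nonneg hH hα, ENNReal.ofReal_rpow_of_nonneg hJ (by positivity),
    ← ENNReal.ofReal_mul (by positivity)]

/-- Hölder for `|f| = (|f| w^(1/p)) · w^(-1/p)`; the second factor, raised to the conjugate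
exponent, is the integrable dual weight. Hence `hilbertOp f` is analytic on the disc. -/
theorem integrableOn_of_memWeighted (hp : 1 < p) (hw : IsTailWeight w)
    (hv : IntegrableOn (fun t => w t ^ (-(1 / (p - 1)))) (Ico (0 : ℝ) 1)) {f : ℝ → ℂ}
    (hf : MemWeighted p w f) : IntegrableOn f (Ico (0 : ℝ) 1) := by
  have hp0 : 0 < p := by linarith
  have hp1 : 0 < p - 1 := by linarith
  refine ⟨hf.1, ?_⟩
  have hwm : AEMeasurable w (volume.restrict (Ico (0 : ℝ) 1)) := hw.cont.aemeasurable measurableSet_Ico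
  have hH := ENNReal.lintegral_mul_le_Lp_mul_Lq (volume.restrict (Ico (0 : ℝ) 1))
    (Real.HolderConjugate.conjExponent hp)
    (f := fun t => ‖f t‖ₑ * ENNReal.ofReal (w t ^ (1 / p)))
    (g := fun t => ENNReal.ofReal (w t ^ (-(1 / p))))
    (hf.1.enorm.mul (hwm.pow_const _).ennreal_ofReal) (hwm.pow_const _).ennreal_ofReal
  have e1 : ∫⁻ t in Ico (0 : ℝ) 1, ‖f t‖ₑ = ∫⁻ t in Ico (0 : ℝ) 1,
      ((fun t => ‖f t‖ₑ * ENNReal.ofReal (w t ^ (1 / p))) *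
        fun t => ENNReal.ofReal (w t ^ (-(1 / p)))) t := by
    refine setLIntegral_congr_fun measurableSet_Ico fun t ht => ?_
    have := hw.pos t ht
    simp only [Pi.mul_apply]
    rw [mul_assoc, ← ENNReal.ofReal_mul (by positivity), ← Real.rpow_add this, add_neg_cancel,
      Real.rpow_zero, ENNReal.ofReal_one, mul_one]
  have e2 : ∫⁻ t in Ico (0 : ℝ) 1, (‖f t‖ₑ * ENNReal.ofReal (w t ^ (1 / p))) ^ p =
      ∫⁻ t in Ico (0 : ℝ) 1, ‖f t‖ₑ ^ p * ENNReal.ofReal (w t) := by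
    refine setLIntegral_congr_fun measurableSet_Ico fun t ht => ?_
    have := hw.pos t ht
    rw [ENNReal.mul_rpow_of_nonneg _ _ hp0.le, ENNReal.ofReal_rpow_of_pos (by positivity),
      ← Real.rpow_mul this.le, show 1 / p * p = 1 by field_simp, Real.rpow_one]
  have e3 : ∫⁻ t in Ico (0 : ℝ) 1, ENNReal.ofReal (w t ^ (-(1 / p))) ^ p.conjExponent =
      ∫⁻ t in Ico (0 : ℝ) 1, ENNReal.ofReal (w t ^ (-(1 / (p - 1)))) := by
    refine setLIntegral_congr_fun measurableSet_Ico fun t ht => ?_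
    have := hw.pos t ht
    rw [ENNReal.ofReal_rpow_of_pos (by positivity), ← Real.rpow_mul this.le, Real.conjExponent,
      show -(1 / p) * (p / (p - 1)) = -(1 / (p - 1)) by field_simp]
  rw [← e1, e2, e3] at hH
  refine lt_of_le_of_lt hH (ENNReal.mul_lt_top hf.2 ?_)
  refine ENNReal.rpow_lt_top_of_nonneg (one_div_nonneg.2 ?_) ?_
  · exact (div_pos hp0 hp1).le
  · have := hv.2
    rw [hasFiniteIntegral_iff_ofReal] at this
    · exact this.ne
    · exact (ae_restrict_iff' measurableSet_Ico).2
        (Filter.Eventually.of_forall fun t ht => (hw.dual_pos _ ht).le)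

/-- A constant for the upper bound of the norm of the Hilbert operator. -/
def upperConst (p : ℝ) : ℝ≥0∞ :=
  (2 * 2 ^ p * (2 ^ (p - 1) * (ENNReal.ofReal (2 * (p - 1)) ^ (p - 1) * 2 * 2 ^ p +
        ENNReal.ofReal (1 - 1 / p)⁻¹ ^ (p - 1) * ENNReal.ofReal p))) ^ (1 / p)

theorem upperConst_ne_top (hp : 1 < p) : upperConst p ≠ ∞ := by
  have hp1 : 0 < p - 1 := by linarith
  have h2 : (2 : ℝ≥0∞) ^ p ≠ ∞ := by simp
  have h3 : (2 : ℝ≥0∞) ^ (p - 1) ≠ ∞ := by simp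
  have h4 : ∀ a : ℝ, ENNReal.ofReal a ^ (p - 1) ≠ ∞ := fun a =>
    ENNReal.rpow_ne_top_of_nonneg hp1.le ENNReal.ofReal_ne_top
  refine ENNReal.rpow_ne_top_of_nonneg (by positivity) ?_
  refine ENNReal.mul_ne_top (ENNReal.mul_ne_top (by simp) h2) (ENNReal.mul_ne_top h3 ?_)
  exact ENNReal.add_ne_top.2 ⟨ENNReal.mul_ne_top (ENNReal.mul_ne_top (h4 _) (by simp)) h2,
    ENNReal.mul_ne_top (h4 _) ENNReal.ofReal_ne_top⟩

theorem bergmanNorm_hilbertOp_le (hp : 1 < p) (h : IsRadialWeight ω)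
    (hc : ContinuousOn ω (Ico (0 : ℝ) 1))
    (hv : IntegrableOn (fun t => hat ω t ^ (-(1 / (p - 1)))) (Ico (0 : ℝ) 1))
    (hM : muckenhoupt p ω < ∞) {f : ℝ → ℂ}
    (hf : AEStronglyMeasurable f (volume.restrict (Ico (0 : ℝ) 1))) :
    bergmanNorm p ω (hilbertOp f) ≤
      upperConst p * muckenhoupt p ω * weightedNorm p (hat ω) f := by
  have hp0 : 0 < p := by linarith
  have hw := h.isTailWeight_hat hc
  have hm : ENNReal.ofReal (muckenhoupt p ω).toReal = muckenhoupt p ω := ENNReal.ofReal_toReal hM.ne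
  have hhalf : 1 / 2 ≤ (muckenhoupt p ω).toReal := by
    rw [← ENNReal.ofReal_le_iff_le_toReal hM.ne]
    exact half_le_muckenhoupt hp hw
  have key := lintegral_kernelAvg_rpow_le hp hw hv hhalf (fun r hr => by
    rw [← ENNReal.ofReal_le_iff_le_toReal hM.ne, ← muckenhoupt_term_eq hp hw hv hr]
    exact le_iSup₂ (f := fun r (_ : r ∈ Ico (0 : ℝ) 1) =>
      (∫⁻ t in Ico r 1, ENNReal.ofReal (hat ω t ^ (-(1 / (p - 1))))) ^ (1 - 1 / p) *
      (∫⁻ t in Ico 0 r, ENNReal.ofReal ((1 - t) ^ (-p) * hat ω t)) ^ (1 / p)) r hr)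
    (g := fun t => ‖f t‖ₑ) (hf.enorm.mono_measure (Measure.restrict_mono Ioo_subset_Ico_self le_rfl))
  rw [hm, setLIntegral_congr (Ioo_ae_eq_Ico (μ := volume) (a := (0 : ℝ)) (b := 1))
    (f := fun t => ‖f t‖ₑ ^ p * ENNReal.ofReal (hat ω t))] at key
  have hup := lintegral_hilbertOp_le hp0 hc hf
  rw [setLIntegral_congr_fun measurableSet_Ioo (fun x hx => by
    rw [← h.ofReal_hat hc ⟨hx.1.le, hx.2⟩])] at hup
  have htot := hup.trans (mul_le_mul_right key _)
  have hpp : ∀ a : ℝ≥0∞, (a ^ p) ^ (1 / p) = a := fun a => by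
    rw [← ENNReal.rpow_mul, show p * (1 / p) = 1 by field_simp, ENNReal.rpow_one]
  rw [bergmanNorm, weightedNorm, upperConst]
  calc _ ≤ _ := ENNReal.rpow_le_rpow htot (by positivity)
    _ = _ := by
      rw [← mul_assoc, ← mul_assoc, ENNReal.mul_rpow_of_nonneg _ _ (by positivity),
        ENNReal.mul_rpow_of_nonneg _ _ (by positivity), hpp]

/-! ### The lower bound by test functions. -/

/-- `T` enters only through nonnegative functions, where both Hilbert operators agree. For each `r`
the test function is a multiple of the dual weight on `[r,1)`, and the output is examined only for
`x < r`. -/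
theorem muckenhoupt_le_opNorm (hp : 1 < p) (h : IsRadialWeight ω)
    (hc : ContinuousOn ω (Ico (0 : ℝ) 1))
    (hv : IntegrableOn (fun t => hat ω t ^ (-(1 / (p - 1)))) (Ico (0 : ℝ) 1))
    {T : (ℝ → ℂ) → (ℂ → ℂ)}
    (hT : ∀ φ : ℝ → ℝ, (∀ t, 0 ≤ φ t) → T (fun t => (φ t : ℂ)) = hilbertOp fun t => (φ t : ℂ)) :
    muckenhoupt p ω ≤ ENNReal.ofReal (4 * Real.pi) * opNorm p ω T := by
  have hp0 : 0 < p := by linarith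
  have hp1 : 0 < p - 1 := by linarith
  have hw := h.isTailWeight_hat hc
  refine iSup₂_le fun r hr => ?_
  rw [muckenhoupt_term_eq hp hw hv hr]
  set w := hat ω with hwdef
  set v : ℝ → ℝ := fun t => w t ^ (-(1 / (p - 1))) with hvdef
  set A := ∫ t in r..1, v t with hA
  set J := ∫ t in 0..r, (1 - t) ^ (-p) * w t with hJ
  have hsub : Ico r 1 ⊆ Ico 0 1 := Ico_subset_Ico_left hr.1
  have hvpos : ∀ t ∈ Ico r 1, 0 < v t := fun t ht => hw.dual_pos _ (hsub ht)
  have hA0 : 0 < A := integral_pos_of_pos hr.2 (hv.mono_set hsub) hvpos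
  have hAl : ENNReal.ofReal A = ∫⁻ t in Ico r 1, ENNReal.ofReal (v t) :=
    ofReal_intervalIntegral hr.2.le (hv.mono_set hsub) fun t ht => (hvpos t ht).le
  have hUnn : ∀ t ∈ Ico 0 r, 0 ≤ (1 - t) ^ (-p) * w t := fun t ht =>
    mul_nonneg (Real.rpow_nonneg (by linarith [ht.2, hr.2]) _) (hw.pos t ⟨ht.1, ht.2.trans hr.2⟩).le
  have hJl : ENNReal.ofReal J = ∫⁻ t in Ico 0 r, ENNReal.ofReal ((1 - t) ^ (-p) * w t) :=
    ofReal_intervalIntegral hr.1 (hw.integrable_one_sub_rpow _ hr.2) hUnn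
  have hJ0 : 0 ≤ J := by
    rw [hJ, intervalIntegral.integral_of_le hr.1, integral_Ioc_eq_integral_Ioo,
      ← integral_Ico_eq_integral_Ioo]
    exact setIntegral_nonneg measurableSet_Ico hUnn
  -- Since `v^p w = v`, this factor gives the test function norm one.
  set c := A ^ (-(1 / p)) with hcdef
  have hc0 : 0 < c := by positivity
  set φ : ℝ → ℝ := (Ico r 1).indicator fun t => c * v t with hφ
  have hφ0 : ∀ t, 0 ≤ φ t := indicator_nonneg fun t ht => mul_nonneg hc0.le (hvpos t ht).le
  have hφi : IntegrableOn φ (Ico (0 : ℝ) 1) := (hv.const_mul c).indicator measurableSet_Ico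
  have hrestr : (volume.restrict (Ico (0 : ℝ) 1)).restrict (Ico r 1) = volume.restrict (Ico r 1) := by
    rw [Measure.restrict_restrict measurableSet_Ico, inter_eq_left.2 hsub]
  have hnorm : weightedNorm p w (fun t => (φ t : ℂ)) = 1 := by
    have : ∫⁻ t in Ico (0 : ℝ) 1, ‖(φ t : ℂ)‖ₑ ^ p * ENNReal.ofReal (w t) =
        ∫⁻ t in Ico r 1, ENNReal.ofReal (A⁻¹) * ENNReal.ofReal (v t) := by
      rw [← hrestr, ← lintegral_indicator measurableSet_Ico (μ := volume.restrict (Ico (0 : ℝ) 1))]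
      refine setLIntegral_congr_fun measurableSet_Ico fun t ht => ?_
      by_cases htr : t ∈ Ico r 1
      · have hvt := hvpos t htr
        have hwt := hw.pos t ht
        simp only [hφ, indicator_of_mem htr]
        rw [← ofReal_norm, Complex.norm_real, Real.norm_of_nonneg (by positivity),
          ENNReal.ofReal_rpow_of_pos (by positivity), ← ENNReal.ofReal_mul (by positivity),
          ← ENNReal.ofReal_mul (by positivity), Real.mul_rpow hc0.le hvt.le, hcdef,
          ← Real.rpow_mul hA0.le, show -(1 / p) * p = -1 by field_simp, Real.rpow_neg_one, mul_assoc]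
        congr 2
        simp only [hvdef]
        rw [← Real.rpow_mul hwt.le]
        conv_lhs => rw [← Real.rpow_one (w t), ← Real.rpow_mul hwt.le, ← Real.rpow_add hwt]
        congr 1
        field_simp
        ring
      · simp [hφ, indicator_of_notMem htr, hp0]
    rw [weightedNorm, this, lintegral_const_mul' _ _ ENNReal.ofReal_ne_top, ← hAl,
      ← ENNReal.ofReal_mul (by positivity), inv_mul_cancel₀ hA0.ne', ENNReal.ofReal_one,
      ENNReal.one_rpow]
  have hmem : MemWeighted p w (fun t => (φ t : ℂ)) :=
    ⟨hφi.ofReal.aestronglyMeasurable, by rw [hnorm]; exact ENNReal.one_lt_top⟩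
  have hop : bergmanNorm p ω (hilbertOp fun t => (φ t : ℂ)) ≤ opNorm p ω T := by
    rw [← hT φ hφ0]
    exact le_iSup_of_le _ (le_iSup₂_of_le hmem hnorm.le le_rfl)
  have hlow := lintegral_kernelAvg_le (p := p) hp0 hc hφi hφ0
  rw [setLIntegral_congr_fun measurableSet_Ioo (fun x hx => by
    rw [← h.ofReal_hat hc ⟨hx.1.le, hx.2⟩])] at hlow
  -- For `x < r ≤ t` one has `1 - t x ≤ 1 - x² ≤ 2 (1 - x)`.
  have hker : ∀ x ∈ Ioo 0 r, ENNReal.ofReal ((2 * (1 - x))⁻¹ * (c * A)) ≤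
      kernelAvg (fun t => ENNReal.ofReal (φ t)) x := by
    intro x hx
    have hx1 : 0 < 1 - x := by linarith [hx.2, hr.2]
    calc _ = ∫⁻ t in Ico r 1, ENNReal.ofReal ((2 * (1 - x))⁻¹ * c) * ENNReal.ofReal (v t) := by
          rw [lintegral_const_mul' _ _ ENNReal.ofReal_ne_top, ← hAl,
            ← ENNReal.ofReal_mul (by positivity), mul_assoc]
      _ ≤ ∫⁻ t in Ico r 1, ENNReal.ofReal (φ t) * ENNReal.ofReal (1 - t * x)⁻¹ := by
          refine setLIntegral_mono' measurableSet_Ico fun t ht => ?_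
          have hvt := hvpos t ht
          have hpos : 0 < 1 - t * x := by nlinarith [ht.2, hx.1]
          simp only [hφ, indicator_of_mem ht]
          rw [← ENNReal.ofReal_mul (by positivity), ← ENNReal.ofReal_mul (by positivity)]
          apply ENNReal.ofReal_le_ofReal
          calc (2 * (1 - x))⁻¹ * c * v t = c * v t * (2 * (1 - x))⁻¹ := by ring
            _ ≤ _ := by
              gcongr
              nlinarith [ht.1, hx.1, hx.2]
      _ ≤ _ := lintegral_mono_set hsub
  have hfin : ENNReal.ofReal ((c * A / 2) ^ p * J) ≤ ENNReal.ofReal (2 * Real.pi) ^ p *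
      ∫⁻ z, ‖hilbertOp (fun t => (φ t : ℂ)) z‖ₑ ^ p * ENNReal.ofReal (ω ‖z‖) ∂areaMeasure := by
    refine le_trans ?_ hlow
    refine le_trans ?_ (le_mul_of_one_le_left zero_le (by norm_num))
    calc _ = ∫⁻ x in Ioo 0 r, ENNReal.ofReal ((c * A / 2) ^ p) *
          ENNReal.ofReal ((1 - x) ^ (-p) * w x) := by
          rw [lintegral_const_mul' _ _ ENNReal.ofReal_ne_top, setLIntegral_congr Ioo_ae_eq_Ico, ← hJl,
            ← ENNReal.ofReal_mul (by positivity)]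
      _ ≤ ∫⁻ x in Ioo 0 r, kernelAvg (fun t => ENNReal.ofReal (φ t)) x ^ p * ENNReal.ofReal (w x) := by
          refine setLIntegral_mono' measurableSet_Ioo fun x hx => ?_
          have hx1 : 0 < 1 - x := by linarith [hx.2, hr.2]
          refine le_trans (le_of_eq ?_) (mul_le_mul_left (ENNReal.rpow_le_rpow (hker x hx) hp0.le) _)
          rw [ENNReal.ofReal_rpow_of_pos (by positivity), ENNReal.ofReal_mul (by positivity),
            ← mul_assoc, ← ENNReal.ofReal_mul (by positivity), Real.rpow_neg hx1.le,
            ← Real.inv_rpow hx1.le, ← Real.mul_rpow (by positivity) (by positivity)]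
          congr 3
          field_simp
      _ ≤ _ := lintegral_mono_set (Ioo_subset_Ioo_right hr.2.le)
  have hroot := ENNReal.rpow_le_rpow hfin (show 0 ≤ 1 / p by positivity)
  have hpp : ∀ a : ℝ≥0∞, (a ^ p) ^ (1 / p) = a := fun a => by
    rw [← ENNReal.rpow_mul, show p * (1 / p) = 1 by field_simp, ENNReal.rpow_one]
  rw [ENNReal.mul_rpow_of_nonneg _ _ (by positivity), hpp,
    ENNReal.ofReal_rpow_of_nonneg (by positivity) (by positivity),
    Real.mul_rpow (by positivity) hJ0, ← Real.rpow_mul (by positivity),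
    show p * (1 / p) = 1 by field_simp, Real.rpow_one] at hroot
  have hcA : c * A = A ^ (1 - 1 / p) := by
    conv_lhs => rw [hcdef, ← Real.rpow_one A, ← Real.rpow_mul hA0.le, ← Real.rpow_add hA0]
    congr 1; ring
  rw [hcA] at hroot
  calc ENNReal.ofReal (A ^ (1 - 1 / p) * J ^ (1 / p))
      = 2 * ENNReal.ofReal (A ^ (1 - 1 / p) / 2 * J ^ (1 / p)) := by
        rw [← ENNReal.ofReal_ofNat, ← ENNReal.ofReal_mul (by norm_num)]
        congr 1; ring
    _ ≤ 2 * (ENNReal.ofReal (2 * Real.pi) * opNorm p ω T) := by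
        gcongr
        exact hroot.trans (mul_le_mul_right hop _)
    _ = _ := by
        rw [← mul_assoc, ← ENNReal.ofReal_ofNat, ← ENNReal.ofReal_mul (by norm_num)]
        congr 2; ring

/-! ### Assembly of the equivalences and norm comparisons. -/

theorem opNorm_le_of_bound {T : (ℝ → ℂ) → (ℂ → ℂ)} {C : ℝ≥0∞}
    (hT : ∀ f, MemWeighted p (hat ω) f → bergmanNorm p ω (T f) ≤ C * weightedNorm p (hat ω) f) :
    opNorm p ω T ≤ C :=
  iSup_le fun f => iSup₂_le fun hf h1 => (hT f hf).trans (mul_le_of_le_one_right zero_le h1)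

theorem muckenhoupt_lt_top_of_isBoundedOp (hp : 1 < p) (h : IsRadialWeight ω)
    (hc : ContinuousOn ω (Ico (0 : ℝ) 1))
    (hv : IntegrableOn (fun t => hat ω t ^ (-(1 / (p - 1)))) (Ico (0 : ℝ) 1))
    {T : (ℝ → ℂ) → (ℂ → ℂ)}
    (hT : ∀ φ : ℝ → ℝ, (∀ t, 0 ≤ φ t) → T (fun t => (φ t : ℂ)) = hilbertOp fun t => (φ t : ℂ))
    (hb : IsBoundedOp p ω T) : muckenhoupt p ω < ∞ := by
  obtain ⟨C, hC⟩ := hb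
  refine (muckenhoupt_le_opNorm hp h hc hv hT).trans_lt
    (ENNReal.mul_lt_top ENNReal.ofReal_lt_top ?_)
  exact (opNorm_le_of_bound fun f hf => (hC f hf).2).trans_lt ENNReal.coe_lt_top

theorem sublinearHilbertOp_of_nonneg {φ : ℝ → ℝ} (h0 : ∀ t, 0 ≤ φ t) :
    sublinearHilbertOp (fun t => (φ t : ℂ)) = hilbertOp fun t => (φ t : ℂ) := by
  funext z
  simp only [sublinearHilbertOp, hilbertOp, Complex.norm_real, Real.norm_of_nonneg (h0 _)]

theorem weightedNorm_norm (f : ℝ → ℂ) :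
    weightedNorm p w (fun t => (‖f t‖ : ℂ)) = weightedNorm p w f := by
  simp only [weightedNorm, ← ofReal_norm, Complex.norm_real, norm_norm]

theorem MemWeighted.norm {f : ℝ → ℂ} (hf : MemWeighted p w f) :
    MemWeighted p w (fun t => (‖f t‖ : ℂ)) :=
  ⟨Complex.continuous_ofReal.comp_aestronglyMeasurable hf.1.norm, by
    rw [weightedNorm_norm]; exact hf.2⟩

end HilbertBergman

end

theorem theorem2 (p : ℝ) (hp : 1 < p) :
    ∃ K : ℝ≥0, ∀ ω : ℝ → ℝ, HilbertBergman.IsRegularWeight ω →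
      IntegrableOn (fun t : ℝ => HilbertBergman.hat ω t ^ (-(1 / (p - 1)))) (Ico (0 : ℝ) 1) →
      List.TFAE [
        HilbertBergman.IsBoundedOp p ω HilbertBergman.hilbertOp,
        HilbertBergman.IsBoundedOp p ω HilbertBergman.sublinearHilbertOp,
        HilbertBergman.muckenhoupt p ω < ∞] ∧
      (HilbertBergman.muckenhoupt p ω < ∞ →
        HilbertBergman.Comparable K
          (HilbertBergman.opNorm p ω HilbertBergman.hilbertOp)
          (HilbertBergman.opNorm p ω HilbertBergman.sublinearHilbertOp) ∧
        HilbertBergman.Comparable K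
          (HilbertBergman.opNorm p ω HilbertBergman.sublinearHilbertOp)
          (HilbertBergman.muckenhoupt p ω) ∧
        HilbertBergman.Comparable K
          (HilbertBergman.opNorm p ω HilbertBergman.hilbertOp)
          (HilbertBergman.muckenhoupt p ω)) := by
  open HilbertBergman in
  set C₁ : ℝ≥0 := (upperConst p).toNNReal with hC₁
  set C₂ : ℝ≥0 := Real.toNNReal (4 * Real.pi) with hC₂
  have hC₁' : (C₁ : ℝ≥0∞) = upperConst p := ENNReal.coe_toNNReal (upperConst_ne_top hp)
  have hC₂1 : 1 ≤ C₂ := by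
    rw [hC₂, Real.one_le_toNNReal]
    linarith [Real.pi_gt_three]
  -- One constant dominating `C₁`, `C₂` and `C₁ C₂`; the product arises when the two operator norms
  -- are compared through the Muckenhoupt constant.
  refine ⟨C₁ * C₂ + C₁ + C₂, fun ω hω hv => ?_⟩
  have hr : IsRadialWeight ω := hω.toIsRadialWeight
  have hc := hω.continuousOn
  have hw := hr.isTailWeight_hat hc
  have upH : muckenhoupt p ω < ∞ → ∀ f, MemWeighted p (hat ω) f →
      bergmanNorm p ω (hilbertOp f) ≤ C₁ * muckenhoupt p ω * weightedNorm p (hat ω) f := by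
    intro hM f hf
    rw [hC₁']
    exact bergmanNorm_hilbertOp_le hp hr hc hv hM hf.1
  have upS : muckenhoupt p ω < ∞ → ∀ f, MemWeighted p (hat ω) f →
      bergmanNorm p ω (sublinearHilbertOp f) ≤
        C₁ * muckenhoupt p ω * weightedNorm p (hat ω) f := by
    intro hM f hf
    rw [← weightedNorm_norm f]
    exact upH hM _ hf.norm
  have bddH : muckenhoupt p ω < ∞ → IsBoundedOp p ω hilbertOp := by
    intro hM
    refine ⟨C₁ * (muckenhoupt p ω).toNNReal, fun f hf => ?_⟩
    have h1 := upH hM f hf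
    rw [← ENNReal.coe_toNNReal hM.ne, ← ENNReal.coe_mul] at h1
    exact ⟨⟨differentiableOn_hilbertOp (integrableOn_of_memWeighted hp hw hv hf),
      h1.trans_lt (ENNReal.mul_lt_top ENNReal.coe_lt_top hf.2)⟩, h1⟩
  have bddS : IsBoundedOp p ω hilbertOp → IsBoundedOp p ω sublinearHilbertOp := by
    rintro ⟨C, hC⟩
    refine ⟨C, fun f hf => ?_⟩
    -- `sublinearHilbertOp f` is by definition `hilbertOp` applied to `|f|`, which has the same
    -- weighted norm as `f`.
    rw [← weightedNorm_norm f]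
    exact hC _ hf.norm
  refine ⟨?_, fun hM => ?_⟩
  · tfae_have 1 → 2 := bddS
    tfae_have 2 → 3 := muckenhoupt_lt_top_of_isBoundedOp hp hr hc hv
      fun φ h0 => sublinearHilbertOp_of_nonneg h0
    tfae_have 3 → 1 := bddH
    tfae_finish
  · have lowH : muckenhoupt p ω ≤ C₂ * opNorm p ω hilbertOp :=
      muckenhoupt_le_opNorm hp hr hc hv fun φ _ => rfl
    have lowS : muckenhoupt p ω ≤ C₂ * opNorm p ω sublinearHilbertOp :=
      muckenhoupt_le_opNorm hp hr hc hv fun φ h0 => sublinearHilbertOp_of_nonneg h0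
    have uH : opNorm p ω hilbertOp ≤ C₁ * muckenhoupt p ω := opNorm_le_of_bound (upH hM)
    have uS : opNorm p ω sublinearHilbertOp ≤ C₁ * muckenhoupt p ω := opNorm_le_of_bound (upS hM)
    have k1 : (C₁ : ℝ≥0∞) ≤ (C₁ * C₂ + C₁ + C₂ : ℝ≥0) := by
      exact_mod_cast le_add_right le_add_self
    have k2 : (C₂ : ℝ≥0∞) ≤ (C₁ * C₂ + C₁ + C₂ : ℝ≥0) := by
      exact_mod_cast le_add_self
    have k3 : (C₁ : ℝ≥0∞) * C₂ ≤ (C₁ * C₂ + C₁ + C₂ : ℝ≥0) := by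
      exact_mod_cast (le_add_right le_self_add : C₁ * C₂ ≤ C₁ * C₂ + C₁ + C₂)
    have cross : ∀ a b : ℝ≥0∞, a ≤ C₁ * muckenhoupt p ω → muckenhoupt p ω ≤ C₂ * b →
        a ≤ (C₁ * C₂ + C₁ + C₂ : ℝ≥0) * b := by
      intro a b h1 h2
      calc a ≤ C₁ * (C₂ * b) := h1.trans (mul_le_mul_right h2 _)
        _ = (C₁ * C₂) * b := by ring
        _ ≤ _ := mul_le_mul_left k3 _
    exact ⟨⟨cross _ _ uH lowS, cross _ _ uS lowH⟩,
      ⟨uS.trans (mul_le_mul_left k1 _), lowS.trans (mul_le_mul_left k2 _)⟩,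
      ⟨uH.trans (mul_le_mul_left k1 _), lowH.trans (mul_le_mul_left k2 _)⟩⟩
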